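/- Let $\mathcal S_1$ be the set of $1$-periodic functions $f:\mathbb R\to\mathbb C$ whose discontinuities all lie in $\mathbb Z$ and which are absolutely continuous on $(0,1)$. Let $r\ge 0$, let $\mathbf f=(f_0,\dots,f_r)$ with $f_k\in\mathcal S_1$ and $f_k'\in\mathcal S_1$ for all $k$ (that is, $f_k$ is differentiable at every non-integer point and its derivative there agrees with a function in $\mathcal S_1$), and let $\boldsymbol\nu=(\nu_0,\dots,\nu_r)$ be a vector of pairwise distinct, pairwise coprime positive integers. Put $$\Delta f_k=f_k(1^-)-f_k(0^+),\qquad \Delta\mathbf f=\prod_{j=0}^r f_j(1^-)-\prod_{j=0}^r f_j(0^+),\qquad c_{j,n}=\int_0^1 f_j(x)e^{-2\pi i n x}\,dx\quad(n\in\mathbb Z),$$ $$S_{\mathbf f}(\boldsymbol\nu|\nu_k)=\sum_{i=1}^{\nu_k-1}\prod_{j\ne k}f_j\!\left(\frac{i\nu_j}{\nu_k}\right),\qquad R_{\mathbf f}(\boldsymbol\nu)=\sum_{k=0}^r S_{\mathbf f}(\boldsymbol\nu|\nu_k)\,\Delta f_k ,$$ and let $\boldsymbol\nu^\perp_{\mathbb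 Z}=\{\mathbf n\in\mathbb Z^{r+1}:\nu_0n_0+\dots+\nu_rn_r=0\}$. Then for every $k$ the lattice sum $$\sum_{\mathbf n\in\boldsymbol\nu^\perp_{\mathbb Z}}\nu_k\prod_{j\ne k}c_{j,n_j}:=\lim_{N\to\infty}\ \sum_{\substack{\mathbf n\in\boldsymbol\nu^\perp_{\mathbb Z}\\ |n_j|\le N\ (0\le j\le r)}}\nu_k\prod_{j\ne k}c_{j,n_j}$$ exists as a principal value, and $$R_{\mathbf f}(\boldsymbol\nu)=\sum_{k=0}^r\Delta f_k\sum_{\mathbf n\in\boldsymbol\nu^\perp_{\mathbb Z}}\nu_k\prod_{j\ne k}c_{j,n_j}-\Delta\mathbf f .$$ -/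

import Mathlib

open Filter Topology

namespace FourierReciprocity

/-- `f` is absolutely continuous on the interval `I`: for every `ε > 0` there is a `δ > 0` such that
every finite family of disjoint intervals `(x i, y i)` with endpoints in `I` and of total length
less than `δ` satisfies `∑ ‖f (y i) - f (x i)‖ < ε`. -/
def AbsContOn (f : ℝ → ℂ) (I : Set ℝ) : Prop :=
  ∀ ε : ℝ, 0 < ε → ∃ δ : ℝ, 0 < δ ∧ ∀ (m : ℕ) (x y : Fin m → ℝ),
    (∀ i, x i ∈ I ∧ y i ∈ I ∧ x i < y i) →
    (Pairwise fun i j => Disjoint (Set.Ioo (x i) (y i)) (Set.Ioo (x j) (y j))) →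
    ∑ i, |y i - x i| < δ → ∑ i, ‖f (y i) - f (x i)‖ < ε

/-- The class `𝒮₁` of `1`-periodic functions `ℝ → ℂ` with discontinuities at most at the integers
that are absolutely continuous on the open interval `(0, 1)`. -/
structure IsS1 (f : ℝ → ℂ) : Prop where
  periodic : ∀ x : ℝ, f (x + 1) = f x
  continuousAt : ∀ x : ℝ, (∀ m : ℤ, x ≠ m) → ContinuousAt f x
  absContOn : AbsContOn f (Set.Ioo 0 1)

/-- The derivative of `f` belongs to `𝒮₁`. The values at the integers, where `f` may jump, play no
role: some function of `𝒮₁` is the derivative of `f` at every non-integer point. -/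
def DerivIsS1 (f : ℝ → ℂ) : Prop :=
  ∃ g : ℝ → ℂ, IsS1 g ∧ ∀ x : ℝ, (∀ m : ℤ, x ≠ m) → HasDerivAt f (g x) x

/-- `f(1⁻)`; the limit exists for every `f` in `𝒮₁`. -/
noncomputable def atOneMinus (f : ℝ → ℂ) : ℂ := limUnder (𝓝[<] (1 : ℝ)) f

/-- `f(0⁺)`; the limit exists for every `f` in `𝒮₁`. -/
noncomputable def atZeroPlus (f : ℝ → ℂ) : ℂ := limUnder (𝓝[>] (0 : ℝ)) f

/-- The jump `Δf = f(1⁻) - f(0⁺)`. -/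
noncomputable def jump (f : ℝ → ℂ) : ℂ := atOneMinus f - atZeroPlus f

/-- `Δ𝐟 = ∏ⱼ fⱼ(1⁻) - ∏ⱼ fⱼ(0⁺)`. -/
noncomputable def vectorJump {r : ℕ} (f : Fin (r + 1) → ℝ → ℂ) : ℂ :=
  ∏ j, atOneMinus (f j) - ∏ j, atZeroPlus (f j)

/-- The generalized Dedekind sum `S_𝐟(ν | νₖ) = ∑_{i=1}^{νₖ-1} ∏_{j ≠ k} fⱼ(i νⱼ / νₖ)`. -/
noncomputable def dedekindSum {r : ℕ} (f : Fin (r + 1) → ℝ → ℂ) (ν : Fin (r + 1) → ℕ)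
    (k : Fin (r + 1)) : ℂ :=
  ∑ i ∈ Finset.Ico 1 (ν k), ∏ j ∈ Finset.univ.erase k, f j ((i : ℝ) * (ν j : ℝ) / (ν k : ℝ))

/-- The reciprocity `R_𝐟(ν) = ∑ₖ S_𝐟(ν | νₖ) Δfₖ`. -/
noncomputable def reciprocity {r : ℕ} (f : Fin (r + 1) → ℝ → ℂ) (ν : Fin (r + 1) → ℕ) : ℂ :=
  ∑ k, dedekindSum f ν k * jump (f k)

/-- The Fourier coefficient `cₙ(f) = ∫₀¹ f(x) exp(-2πinx) dx`. -/
noncomputable def fourierCoef (f : ℝ → ℂ) (n : ℤ) : ℂ :=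
  ∫ x in (0 : ℝ)..1, f x * Complex.exp (2 * Real.pi * Complex.I * (-(n : ℂ) * (x : ℂ)))

/-- `c_{k,𝐧} = ∏_{j ≠ k} c_{nⱼ}(fⱼ)`. -/
noncomputable def coefProd {r : ℕ} (f : Fin (r + 1) → ℝ → ℂ) (k : Fin (r + 1))
    (n : Fin (r + 1) → ℤ) : ℂ :=
  ∏ j ∈ Finset.univ.erase k, fourierCoef (f j) (n j)

/-- The lattice `ν^⊥ ∩ ℤ^{r+1}` of integer vectors orthogonal to `ν`. -/
def orthLattice {r : ℕ} (ν : Fin (r + 1) → ℕ) : Set (Fin (r + 1) → ℤ) :=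
  {n | ∑ j, (ν j : ℤ) * n j = 0}

open Classical in
/-- The sum of `a` over the points `n` of `L` with `|nⱼ| ≤ N` for all coordinates `j`. -/
noncomputable def cubeSum {r : ℕ} (L : Set (Fin (r + 1) → ℤ)) (a : (Fin (r + 1) → ℤ) → ℂ)
    (N : ℕ) : ℂ :=
  ∑ n ∈ (Fintype.piFinset fun _ : Fin (r + 1) => Finset.Icc (-(N : ℤ)) (N : ℤ)) with n ∈ L, a n

/-- The sum `∑_{n ∈ L} a n` converges to `s` as a principal value: its symmetric partial sums, over
the points of `L` in the cube `[-N, N]^{r+1}`, tend to `s` as `N → ∞`. -/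
def HasPrincipalValue {r : ℕ} (L : Set (Fin (r + 1) → ℤ)) (a : (Fin (r + 1) → ℤ) → ℂ)
    (s : ℂ) : Prop :=
  Tendsto (cubeSum L a) atTop (𝓝 s)

end FourierReciprocity

/-! Write s_N(f) for the N-th symmetric Fourier sum and D_N for the Dirichlet kernel. Integration by
parts gives 2πi n c_n(f_k) = c_n(f_k') − Δf_k, hence s_N(f_k)' = s_N(f_k') − Δf_k D_N. The product
of the s_N(f_j)(ν_j x) is a 1-periodic trigonometric polynomial, so its derivative integrates to 0
over [0,1]. By orthogonality of characters, ν_k ∫ D_N(ν_k x) ∏_{j≠k} s_N(f_j)(ν_j x) dx is the k-th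
cube sum. Thus, for every N, the cube sums weighted by Δf_k add up to ∑_k ν_k ∫ s_N(f_k')(ν_k x)
∏_{j≠k} s_N(f_j)(ν_j x) dx.

As N → ∞ the latter tends to the integral of the classical derivative of F(x) = ∏ f_j(ν_j x)
(`tendsto_integral_trigSum_mul_prod`), which is F(1⁻) − F(0⁺) minus the jumps of F inside (0,1). At
i/ν_k coprimality leaves f_k as the only factor that can jump, and the jumps total −R
(`sum_integral_deriv_prod`).

This settles only the weighted combination; the convergence of each lattice sum is the analytic core
(`exists_hasPrincipalValue`). The integral is cut into ν_k windows around the peaks of D_N(ν_k x).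
In a window, each other factor is its value at the centre, plus a multiple of a dilated sine
integral Si((2N+1)πay) (the Gibbs phenomenon), plus an error O(|y|^{1/4}) uniform in N
(`IsTame.exists_expansion`). The error tames the 1/y of the kernel, so its contribution dies by
Riemann–Lebesgue. The main terms rescale to integrals of sinc(t) ∏ Si(at), which converge
conditionally. An induction over the factors, `IsGood.mul_trigSum`, assembles these pieces. -/

namespace FourierReciprocity

open MeasureTheory intervalIntegral

/-! ### Characters and trigonometric polynomials -/

/-- The additive character `e(x) = exp(2πix)`. -/
noncomputable def expChar (x : ℝ) : ℂ := Complex.exp (2 * Real.pi * Complex.I * x)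

lemma expChar_add (x y : ℝ) : expChar (x + y) = expChar x * expChar y := by
  simp [expChar, mul_add, Complex.exp_add]

@[simp] lemma expChar_zero : expChar 0 = 1 := by simp [expChar]

lemma expChar_sum {ι : Type*} (s : Finset ι) (x : ι → ℝ) :
    expChar (∑ i ∈ s, x i) = ∏ i ∈ s, expChar (x i) := by
  classical
  induction s using Finset.induction_on with
  | empty => simp
  | insert a s ha ih => rw [Finset.sum_insert ha, Finset.prod_insert ha, expChar_add, ih]

@[simp] lemma expChar_intCast (n : ℤ) : expChar n = 1 := by
  rw [expChar, Complex.exp_eq_one_iff]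
  exact ⟨n, by push_cast; ring⟩

@[simp] lemma norm_expChar (x : ℝ) : ‖expChar x‖ = 1 := by
  have : (2 * Real.pi * Complex.I * x : ℂ) = ((2 * Real.pi * x : ℝ) : ℂ) * Complex.I := by
    push_cast; ring
  rw [expChar, this, Complex.norm_exp_ofReal_mul_I]

@[fun_prop] lemma continuous_expChar : Continuous expChar := by
  unfold expChar; fun_prop

lemma hasDerivAt_expChar_mul (a x : ℝ) :
    HasDerivAt (fun x : ℝ => expChar (a * x)) (2 * Real.pi * Complex.I * a * expChar (a * x)) x := by
  have h : HasDerivAt (fun x : ℝ => (2 * Real.pi * Complex.I * a : ℂ) * (x : ℂ))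
      ((2 * Real.pi * Complex.I * a : ℂ) * 1) x :=
    (Complex.ofRealCLM.hasDerivAt (x := x)).const_mul _
  have h2 := h.cexp
  convert! h2 using 1
  · ext y; simp only [expChar]; congr 1; push_cast; ring
  · simp only [expChar]; push_cast
    rw [show (2 * Real.pi * Complex.I * a * (x:ℂ)) = 2 * Real.pi * Complex.I * (a * x) by ring]; ring

lemma integral_expChar_intCast_mul (m : ℤ) :
    ∫ x in (0 : ℝ)..1, expChar (m * x) = if m = 0 then 1 else 0 := by
  split_ifs with h
  · simp [h]
  · have hm : (2 * Real.pi * Complex.I * (m : ℝ) : ℂ) ≠ 0 := by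
      simp [h, Real.pi_ne_zero]
    have hd : ∀ x : ℝ, HasDerivAt (fun x : ℝ => expChar (m * x) / (2 * Real.pi * Complex.I * (m : ℝ)))
        (expChar (m * x)) x := fun x => by
      have := (hasDerivAt_expChar_mul m x).div_const (2 * Real.pi * Complex.I * (m : ℝ))
      rwa [mul_div_cancel_left₀ _ hm] at this
    rw [integral_eq_sub_of_hasDerivAt (fun x _ => hd x)
      ((by fun_prop : Continuous fun x : ℝ => expChar (m * x)).intervalIntegrable _ _)]
    simp

/-- The trigonometric polynomial `∑_{|n| ≤ N} cₙ e(nx)`. -/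
noncomputable def trigSum (c : ℤ → ℂ) (N : ℕ) (x : ℝ) : ℂ :=
  ∑ n ∈ Finset.Icc (-(N : ℤ)) (N : ℤ), c n * expChar (n * x)

/-- The Dirichlet kernel. -/
noncomputable def dirichletKernel (N : ℕ) (x : ℝ) : ℂ := trigSum (fun _ => 1) N x

@[fun_prop] lemma continuous_trigSum (c : ℤ → ℂ) (N : ℕ) : Continuous (trigSum c N) := by
  unfold trigSum; fun_prop

@[fun_prop] lemma continuous_dirichletKernel (N : ℕ) : Continuous (dirichletKernel N) :=
  continuous_trigSum _ _

lemma trigSum_add_int (c : ℤ → ℂ) (N : ℕ) (x : ℝ) (m : ℤ) :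
    trigSum c N (x + m) = trigSum c N x := by
  unfold trigSum
  refine Finset.sum_congr rfl fun n _ => ?_
  rw [mul_add, expChar_add, show (n : ℝ) * (m : ℝ) = ((n * m : ℤ) : ℝ) by push_cast; ring,
    expChar_intCast, mul_one]

lemma trigSum_intCast (c : ℤ → ℂ) (N : ℕ) (m : ℤ) : trigSum c N m = trigSum c N 0 := by
  simpa using trigSum_add_int c N 0 m

lemma hasDerivAt_trigSum (c : ℤ → ℂ) (N : ℕ) (x : ℝ) :
    HasDerivAt (trigSum c N) (trigSum (fun n => 2 * Real.pi * Complex.I * n * c n) N x) x := by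
  unfold trigSum
  refine (HasDerivAt.fun_sum fun (n : ℤ) _ => (hasDerivAt_expChar_mul n x).const_mul (c n)).congr_deriv ?_
  refine Finset.sum_congr rfl fun n _ => ?_
  push_cast; ring

lemma hasDerivAt_trigSum_comp_mul (c : ℤ → ℂ) (N : ℕ) (a x : ℝ) :
    HasDerivAt (fun x => trigSum c N (a * x))
      (a * trigSum (fun n => 2 * Real.pi * Complex.I * n * c n) N (a * x)) x := by
  have h := (hasDerivAt_trigSum c N (a * x)).scomp x ((hasDerivAt_id x).const_mul a)
  simpa [Function.comp_def] using h

/-! ### Lattice sums as integrals -/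

/-- Multiplying out the product gives characters of frequency ∑ ν_j n_j, and integration over a
period keeps exactly those of frequency 0. -/
lemma cubeSum_prod_eq_integral {r : ℕ} (ν : Fin (r + 1) → ℕ) (c : Fin (r + 1) → ℤ → ℂ) (N : ℕ) :
    cubeSum (orthLattice ν) (fun n => ∏ j, c j (n j)) N
      = ∫ x in (0 : ℝ)..1, ∏ j, trigSum (c j) N (ν j * x) := by
  classical
  have h1 : ∀ x : ℝ, ∏ j, trigSum (c j) N (ν j * x)
      = ∑ n ∈ (Fintype.piFinset fun _ : Fin (r + 1) => Finset.Icc (-(N : ℤ)) (N : ℤ)),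
        (∏ j, c j (n j)) * expChar ((∑ j, (ν j : ℤ) * n j : ℤ) * x) := by
    intro x
    unfold trigSum
    rw [Finset.prod_univ_sum]
    refine Finset.sum_congr rfl fun n _ => ?_
    rw [Finset.prod_mul_distrib]
    congr 1
    rw [← expChar_sum]
    congr 1
    push_cast
    rw [Finset.sum_mul]
    exact Finset.sum_congr rfl fun j _ => by ring
  simp_rw [h1]
  rw [integral_finsetSum fun n _ => Continuous.intervalIntegrable (by fun_prop) _ _]
  simp_rw [intervalIntegral.integral_const_mul, integral_expChar_intCast_mul]
  unfold cubeSum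
  rw [Finset.sum_filter]
  refine Finset.sum_congr rfl fun n _ => ?_
  by_cases h : ∑ j, (ν j : ℤ) * n j = 0
  · simp [orthLattice, h]
  · simp [orthLattice, h]

/-- The omitted k-th coefficient counts as the constant 1, whose trigonometric sum is the Dirichlet
kernel. -/
lemma cubeSum_coefProd_eq_integral {r : ℕ} (f : Fin (r + 1) → ℝ → ℂ) (ν : Fin (r + 1) → ℕ)
    (k : Fin (r + 1)) (N : ℕ) :
    cubeSum (orthLattice ν) (fun n => (ν k : ℂ) * coefProd f k n) N
      = ν k * ∫ x in (0 : ℝ)..1, dirichletKernel N (ν k * x) *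
        ∏ j ∈ Finset.univ.erase k, trigSum (fourierCoef (f j)) N (ν j * x) := by
  classical
  have h1 : cubeSum (orthLattice ν) (fun n => (ν k : ℂ) * coefProd f k n) N
      = ν k * cubeSum (orthLattice ν) (fun n => coefProd f k n) N := by
    simp [cubeSum, Finset.mul_sum]
  have h2 : (fun n => coefProd f k n) = fun n : Fin (r + 1) → ℤ =>
      ∏ j, (if j = k then fun _ => (1 : ℂ) else fourierCoef (f j)) (n j) := by
    ext n
    rw [← Finset.mul_prod_erase _ _ (Finset.mem_univ k)]
    simp only [if_true, one_mul, coefProd]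
    exact Finset.prod_congr rfl fun j hj => by rw [if_neg (Finset.ne_of_mem_erase hj)]
  rw [h1, h2, cubeSum_prod_eq_integral]
  congr 2
  ext x
  rw [← Finset.mul_prod_erase _ _ (Finset.mem_univ k)]
  simp only [if_true, dirichletKernel]
  congr 1
  exact Finset.prod_congr rfl fun j hj => by rw [if_neg (Finset.ne_of_mem_erase hj)]

/-- The integrands add up to the derivative of a product that takes equal values at 0 and 1, because
the dilations ν_j are integers. -/
lemma sum_integral_deriv_trigSum_eq_zero {r : ℕ} (ν : Fin (r + 1) → ℕ)
    (c : Fin (r + 1) → ℤ → ℂ) (N : ℕ) :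
    ∑ k, ∫ x in (0 : ℝ)..1, ν k * (trigSum (fun n => 2 * Real.pi * Complex.I * n * c k n) N (ν k * x) *
      ∏ j ∈ Finset.univ.erase k, trigSum (c j) N (ν j * x)) = 0 := by
  classical
  rw [← integral_finsetSum fun n _ => Continuous.intervalIntegrable (by fun_prop) _ _]
  have hd : ∀ x : ℝ, HasDerivAt (fun x : ℝ => ∏ j, trigSum (c j) N (ν j * x))
      (∑ k, ν k * (trigSum (fun n => 2 * Real.pi * Complex.I * n * c k n) N (ν k * x) *
        ∏ j ∈ Finset.univ.erase k, trigSum (c j) N (ν j * x))) x := fun x => by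
    refine (HasDerivAt.fun_finsetProd fun j _ =>
      hasDerivAt_trigSum_comp_mul (c j) N (ν j) x).congr_deriv ?_
    refine Finset.sum_congr rfl fun k _ => ?_
    simp only [smul_eq_mul]; push_cast; ring
  rw [integral_eq_sub_of_hasDerivAt (fun x _ => hd x)
    (Continuous.intervalIntegrable (by fun_prop) _ _), sub_eq_zero]
  refine Finset.prod_congr rfl fun j _ => ?_
  have := trigSum_intCast (c j) N (ν j)
  simpa using this

/-! ### The Dirichlet kernel and Riemann–Lebesgue -/

lemma trigSum_zero_order (c : ℤ → ℂ) (x : ℝ) : trigSum c 0 x = c 0 := by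
  simp [trigSum]

lemma trigSum_succ (c : ℤ → ℂ) (N : ℕ) (x : ℝ) :
    trigSum c (N + 1) x = trigSum c N x + (c (N + 1) * expChar ((N + 1) * x)
      + c (-(N + 1)) * expChar (-((N + 1) * x))) := by
  have h : Finset.Icc (-((N + 1 : ℕ) : ℤ)) ((N + 1 : ℕ) : ℤ)
      = insert ((N : ℤ) + 1) (insert (-((N : ℤ) + 1)) (Finset.Icc (-(N : ℤ)) (N : ℤ))) := by
    ext n; simp only [Finset.mem_Icc, Finset.mem_insert]; omega
  unfold trigSum
  rw [h, Finset.sum_insert, Finset.sum_insert]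
  · push_cast
    rw [neg_mul]; ring
  · simp
  · simp only [Finset.mem_insert, Finset.mem_Icc]; omega

lemma expChar_add_expChar_neg (x : ℝ) :
    expChar x + expChar (-x) = ((2 * Real.cos (2 * Real.pi * x) : ℝ) : ℂ) := by
  push_cast
  rw [Complex.two_cos, expChar, expChar]
  push_cast
  congr 2 <;> ring

lemma dirichletKernel_mul_sin (N : ℕ) (x : ℝ) :
    dirichletKernel N x * (Real.sin (Real.pi * x) : ℝ) = (Real.sin ((2 * N + 1) * Real.pi * x) : ℝ) := by
  unfold dirichletKernel
  induction N with
  | zero => simp [trigSum_zero_order]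
  | succ N ih =>
    rw [trigSum_succ, one_mul, one_mul, expChar_add_expChar_neg, add_mul, ih]
    rw [← Complex.ofReal_mul, ← Complex.ofReal_add, Complex.ofReal_inj,
      show (2 * ((N + 1 : ℕ) : ℝ) + 1) * Real.pi * x
        = 2 * Real.pi * ((N + 1) * x) + Real.pi * x by push_cast; ring,
      show (2 * (N : ℝ) + 1) * Real.pi * x = 2 * Real.pi * ((N + 1) * x) - Real.pi * x by ring,
      Real.sin_add, Real.sin_sub]
    ring

/-- The Riemann–Lebesgue lemma for the frequencies `(2N + 1) / 2`. -/
lemma tendsto_integral_sin_mul {h : ℝ → ℂ} {a b : ℝ} (hab : a ≤ b)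
    (hh : IntervalIntegrable h volume a b) :
    Tendsto (fun N : ℕ => ∫ y in a..b, ((Real.sin ((2 * N + 1) * Real.pi * y) : ℝ) : ℂ) * h y)
      atTop (𝓝 0) := by
  have hI : Integrable ((Set.Ioc a b).indicator h) :=
    (integrable_indicator_iff measurableSet_Ioc).2 ((intervalIntegrable_iff_integrableOn_Ioc_of_le hab).1 hh)
  have hRL := Real.tendsto_integral_exp_smul_cocompact ((Set.Ioc a b).indicator h)
  have hlim : Tendsto (fun N : ℕ => (2 * (N : ℝ) + 1) / 2) atTop atTop := by
    refine Tendsto.atTop_div_const (by norm_num) (tendsto_atTop_add_const_right _ _ ?_)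
    exact tendsto_natCast_atTop_atTop.const_mul_atTop (by norm_num)
  have h1 := hRL.comp (hlim.mono_right atTop_le_cocompact)
  have h2 := hRL.comp ((tendsto_neg_atTop_atBot.comp hlim).mono_right atBot_le_cocompact)
  have h3 := ((h1.sub h2).const_mul (Complex.I / 2))
  simp only [sub_zero, mul_zero] at h3
  refine h3.congr fun N => ?_
  simp only [Function.comp]
  have hconv : ∀ w : ℝ, Integrable fun v => Real.fourierChar (-(v * w)) • (Set.Ioc a b).indicator h v :=
    fun w => by simpa [mul_comm] using (Real.fourierIntegral_convergent_iff w).2 hI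
  rw [← integral_sub (hconv _) (hconv _),
    integral_of_le hab, ← MeasureTheory.integral_const_mul, ← MeasureTheory.integral_indicator measurableSet_Ioc]
  congr 1
  ext y
  by_cases hy : y ∈ Set.Ioc a b
  · simp only [Set.indicator_of_mem hy, Circle.smul_def, Real.fourierChar_apply, smul_eq_mul]
    push_cast
    rw [Complex.sin]
    rw [show (2 * Real.pi * -((y : ℂ) * -((2 * N + 1) / 2)) * Complex.I)
      = (2 * N + 1) * Real.pi * y * Complex.I by ring,
      show (2 * Real.pi * -((y : ℂ) * ((2 * N + 1) / 2)) * Complex.I)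
      = -((2 * N + 1) * Real.pi * y) * Complex.I by ring]
    ring
  · simp [Set.indicator_of_notMem hy]

/-- A Riemann–Lebesgue lemma for dominated, almost everywhere convergent sequences. -/
lemma tendsto_integral_sin_mul_of_dominated {h : ℕ → ℝ → ℂ} {a b : ℝ} (hab : a ≤ b) {Φ : ℝ → ℝ}
    (hΦ : IntervalIntegrable Φ volume a b)
    (hmeas : ∀ N, AEStronglyMeasurable (h N) (volume.restrict (Set.uIoc a b)))
    (hbound : ∀ N, ∀ᵐ y, y ∈ Set.uIoc a b → ‖h N y‖ ≤ Φ y)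
    (hlim : ∀ᵐ y, y ∈ Set.uIoc a b → ∃ l, Tendsto (fun N => h N y) atTop (𝓝 l)) :
    Tendsto (fun N : ℕ => ∫ y in a..b, ((Real.sin ((2 * N + 1) * Real.pi * y) : ℝ) : ℂ) * h N y)
      atTop (𝓝 0) := by
  set H : ℝ → ℂ := fun y => limUnder atTop fun N => h N y
  have hH : ∀ᵐ y, y ∈ Set.uIoc a b → Tendsto (fun N => h N y) atTop (𝓝 (H y)) := by
    filter_upwards [hlim] with y hy hmem using tendsto_nhds_limUnder (hy hmem)
  have hHmeas : AEStronglyMeasurable H (volume.restrict (Set.uIoc a b)) :=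
    aestronglyMeasurable_of_tendsto_ae atTop hmeas
      ((ae_restrict_iff' measurableSet_uIoc).2 hH)
  have hHbound : ∀ᵐ y, y ∈ Set.uIoc a b → ‖H y‖ ≤ Φ y := by
    filter_upwards [hH, ae_all_iff.2 hbound] with y hy hb hmem
    exact le_of_tendsto (hy hmem).norm (Eventually.of_forall fun N => hb N hmem)
  have hΦn : ∀ᵐ y, y ∈ Set.uIoc a b → ‖Φ y‖ = Φ y := by
    filter_upwards [hHbound] with y hy hmem
    rw [Real.norm_of_nonneg ((norm_nonneg _).trans (hy hmem))]
  have hHint : IntervalIntegrable H volume a b := by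
    refine hΦ.mono_fun hHmeas ?_
    rw [EventuallyLE, ae_restrict_iff' measurableSet_uIoc]
    filter_upwards [hHbound, hΦn] with y hy h2 hmem
    rw [h2 hmem]; exact hy hmem
  have hNint : ∀ N, IntervalIntegrable (h N) volume a b := fun N => by
    refine hΦ.mono_fun (hmeas N) ?_
    rw [EventuallyLE, ae_restrict_iff' measurableSet_uIoc]
    filter_upwards [hbound N, hΦn] with y hy h2 hmem
    rw [h2 hmem]; exact hy hmem
  have hsin : ∀ N : ℕ, Continuous fun y : ℝ => ((Real.sin ((2 * N + 1) * Real.pi * y) : ℝ) : ℂ) :=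
    fun N => by fun_prop
  have hs1 : ∀ (N : ℕ) (y : ℝ), ‖((Real.sin ((2 * N + 1) * Real.pi * y) : ℝ) : ℂ)‖ ≤ 1 :=
    fun N y => by rw [Complex.norm_real]; exact Real.abs_sin_le_one _
  -- Split h_N = (h_N − H) + H: dominated convergence handles the difference, the fixed-function
  -- lemma handles H.
  have hA : Tendsto (fun N : ℕ => ∫ y in a..b,
      ((Real.sin ((2 * N + 1) * Real.pi * y) : ℝ) : ℂ) * (h N y - H y)) atTop
      (𝓝 (∫ y in a..b, (0 : ℂ))) := by
    refine tendsto_integral_filter_of_dominated_convergence (fun y => 2 * Φ y)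
      (Eventually.of_forall fun N => (hsin N).aestronglyMeasurable.mul ((hmeas N).sub hHmeas))
      (Eventually.of_forall fun N => ?_) (hΦ.const_mul 2) ?_
    · filter_upwards [hbound N, hHbound] with y h1 h2 hmem
      rw [norm_mul]
      calc _ ≤ 1 * ‖h N y - H y‖ := by gcongr; exact hs1 N y
        _ ≤ ‖h N y‖ + ‖H y‖ := by rw [one_mul]; exact norm_sub_le _ _
        _ ≤ 2 * Φ y := by linarith [h1 hmem, h2 hmem]
    · filter_upwards [hH] with y hy hmem
      have := tendsto_iff_norm_sub_tendsto_zero.1 (hy hmem)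
      refine squeeze_zero_norm (fun N => ?_) this
      rw [norm_mul]
      calc _ ≤ 1 * ‖h N y - H y‖ := by gcongr; exact hs1 N y
        _ = _ := one_mul _
  have hB := tendsto_integral_sin_mul hab hHint
  rw [intervalIntegral.integral_zero] at hA
  have := hA.add hB
  rw [add_zero] at this
  refine this.congr fun N => ?_
  rw [← integral_add (((hNint N).sub hHint).continuousOn_mul (hsin N).continuousOn)
    (hHint.continuousOn_mul (hsin N).continuousOn)]
  congr 1; ext y; ring

lemma two_mul_abs_le_abs_sin {y : ℝ} (hy : |y| ≤ 1 / 2) : 2 * |y| ≤ |Real.sin (Real.pi * y)| := by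
  have h := Real.mul_abs_le_abs_sin (x := Real.pi * y) (by
    rw [abs_mul, abs_of_pos Real.pi_pos]; nlinarith [Real.pi_pos])
  rw [abs_mul, abs_of_pos Real.pi_pos] at h
  convert h using 1
  field_simp

lemma sin_pi_mul_ne_zero {y : ℝ} (hy : |y| ≤ 1 / 2) (h0 : y ≠ 0) : Real.sin (Real.pi * y) ≠ 0 := by
  have := two_mul_abs_le_abs_sin hy
  have h1 : 0 < |y| := abs_pos.2 h0
  exact abs_pos.1 (by linarith)

lemma intervalIntegrable_abs_rpow {s : ℝ} (hs : -1 < s) (a : ℝ) (ha : 0 ≤ a) :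
    IntervalIntegrable (fun y : ℝ => |y| ^ s) volume (-a) a := by
  have h1 : IntervalIntegrable (fun y : ℝ => |y| ^ s) volume 0 a := by
    refine (intervalIntegral.intervalIntegrable_rpow' hs (a := 0) (b := a)).congr fun y hy => ?_
    rw [Set.uIoc_of_le ha] at hy
    simp only [abs_of_pos hy.1]
  have h2 := (IntervalIntegrable.iff_comp_neg (a := 0) (b := a) (f := fun y : ℝ => |y| ^ s)).1 h1
  simp only [abs_neg, neg_zero] at h2
  exact h2.symm.trans h1

/-- If `g_N(y) = O(|y|^{1/4})` uniformly and `g_N` converges almost everywhere, then the integrals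
of `g_N` against the Dirichlet kernels tend to `0`. -/
lemma tendsto_integral_dirichletKernel_mul {g : ℕ → ℝ → ℂ} {C : ℝ}
    (hmeas : ∀ N, AEStronglyMeasurable (g N) (volume.restrict (Set.uIoc (-(1 / 2)) (1 / 2))))
    (hbound : ∀ N y, |y| ≤ 1 / 2 → ‖g N y‖ ≤ C * |y| ^ (1 / 4 : ℝ))
    (hlim : ∀ᵐ y, ∃ l, Tendsto (fun N => g N y) atTop (𝓝 l)) :
    Tendsto (fun N => ∫ y in (-(1 / 2) : ℝ)..(1 / 2), dirichletKernel N y * g N y) atTop (𝓝 0) := by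
  have hle : (-(1 / 2) : ℝ) ≤ 1 / 2 := by norm_num
  have hmem : ∀ y : ℝ, y ∈ Set.uIoc (-(1 / 2) : ℝ) (1 / 2) → |y| ≤ 1 / 2 := fun y hy => by
    rw [Set.uIoc_of_le hle] at hy
    exact abs_le.2 ⟨hy.1.le, hy.2⟩
  have h0 : ∀ᵐ y : ℝ, y ≠ 0 := by simp [ae_iff]
  -- Divide by sin(πy), which is at least 2|y| in modulus: the bound |y|^{1/4} becomes |y|^{-3/4}/2,
  -- still integrable at 0.
  have key := tendsto_integral_sin_mul_of_dominated (h := fun N y => (((Real.sin (Real.pi * y) : ℝ) : ℂ))⁻¹ * g N y)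
    (Φ := fun y => C / 2 * |y| ^ (-(3 / 4) : ℝ)) hle
    ((intervalIntegrable_abs_rpow (by norm_num) _ (by norm_num)).const_mul _)
    (fun N => ?_) (fun N => ?_) ?_
  · refine key.congr fun N => ?_
    refine intervalIntegral.integral_congr_ae ?_
    filter_upwards [h0] with y hy hy2
    have hs : ((Real.sin (Real.pi * y) : ℝ) : ℂ) ≠ 0 := by
      exact_mod_cast sin_pi_mul_ne_zero (hmem y hy2) hy
    rw [← dirichletKernel_mul_sin]
    field_simp
  · refine AEStronglyMeasurable.mul ?_ (hmeas N)
    have : Measurable fun y : ℝ => (((Real.sin (Real.pi * y) : ℝ) : ℂ))⁻¹ := by fun_prop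
    exact this.aestronglyMeasurable
  · filter_upwards [h0] with y hy hy2
    have hy3 := hmem y hy2
    have h1 := two_mul_abs_le_abs_sin hy3
    have hpos : 0 < |y| := abs_pos.2 hy
    have hb := hbound N y hy3
    rw [norm_mul, norm_inv, Complex.norm_real, Real.norm_eq_abs]
    have e1 : |y| ^ (-(3 / 4) : ℝ) = |y|⁻¹ * |y| ^ (1 / 4 : ℝ) := by
      rw [← Real.rpow_neg_one, ← Real.rpow_add hpos]; norm_num
    calc |Real.sin (Real.pi * y)|⁻¹ * ‖g N y‖ ≤ (2 * |y|)⁻¹ * (C * |y| ^ (1 / 4 : ℝ)) := by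
          gcongr
      _ = _ := by rw [e1, mul_inv]; ring
  · filter_upwards [hlim] with y ⟨l, hl⟩ _
    exact ⟨_, hl.const_mul _⟩

/-! ### The sine integral and conditionally convergent integrals -/

/-- The sine integral. -/
noncomputable def sineIntegral (x : ℝ) : ℝ := ∫ t in (0 : ℝ)..x, Real.sinc t

lemma hasDerivAt_sineIntegral (x : ℝ) : HasDerivAt sineIntegral (Real.sinc x) x :=
  integral_hasDerivAt_right (Real.continuous_sinc.intervalIntegrable _ _)
    (Real.continuous_sinc.stronglyMeasurableAtFilter _ _) Real.continuous_sinc.continuousAt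

@[fun_prop] lemma continuous_sineIntegral : Continuous sineIntegral :=
  continuous_iff_continuousAt.2 fun x => (hasDerivAt_sineIntegral x).continuousAt

@[simp] lemma sineIntegral_zero : sineIntegral 0 = 0 := by simp [sineIntegral]

lemma sineIntegral_neg (x : ℝ) : sineIntegral (-x) = -sineIntegral x := by
  have := intervalIntegral.integral_comp_neg (a := 0) (b := x) Real.sinc
  simp only [Real.sinc_neg, neg_zero] at this
  rw [sineIntegral, sineIntegral, this, integral_symm]

/-- Conditional convergence of `∫₀^∞ sinc(t) W(t) dt` for bounded `W` with `W' = O(1/t)`. -/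
lemma exists_tendsto_integral_sinc_mul {W : ℝ → ℝ} {C : ℝ} (hW : Continuous W)
    (hb : ∀ t, |W t| ≤ C) (hd : ∀ t, 0 < t → DifferentiableAt ℝ W t)
    (hd' : ∀ t, 0 < t → |deriv W t| ≤ C / t) :
    ∃ L, Tendsto (fun T : ℝ => ∫ t in (0 : ℝ)..T, Real.sinc t * W t) atTop (𝓝 L) := by
  have hC : 0 ≤ C := (abs_nonneg _).trans (hb 0)
  -- Integration by parts: −cos(t) W(t)/t has derivative sinc(t) W(t) − q(t), and q = O(t⁻²) is
  -- integrable at infinity.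
  set q : ℝ → ℝ := fun t => Real.cos t * (deriv W t / t - W t / t ^ 2) with hq
  have hqi : IntegrableOn q (Set.Ioi 1) := by
    have h1 := (integrableOn_Ioi_rpow_of_lt (a := -2) (by norm_num) (c := 1) one_pos).const_mul (2 * C)
    refine Integrable.mono' h1 ?_ ?_
    · have : Measurable q := by
        have := measurable_deriv W
        have := hW.measurable
        fun_prop
      exact this.aestronglyMeasurable
    · refine (ae_restrict_iff' measurableSet_Ioi).2 (Eventually.of_forall fun t ht => ?_)
      have ht0 : (0 : ℝ) < t := lt_trans one_pos ht
      rw [hq, norm_mul]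
      calc _ ≤ 1 * (|deriv W t| / t + |W t| / t ^ 2) := by
            gcongr
            · exact Real.abs_cos_le_one t
            · refine (norm_sub_le _ _).trans (le_of_eq ?_)
              rw [norm_div, norm_div, Real.norm_eq_abs, Real.norm_eq_abs, Real.norm_eq_abs,
                abs_of_pos ht0, Real.norm_of_nonneg (by positivity)]
        _ ≤ 1 * ((C / t) / t + C / t ^ 2) := by
            gcongr
            · exact hd' t ht0
            · exact hb t
        _ = 2 * C * t ^ (-2 : ℝ) := by
            rw [Real.rpow_neg ht0.le, Real.rpow_two]; field_simp; ring
  have hlim := intervalIntegral_tendsto_integral_Ioi 1 hqi tendsto_id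
  have hV : Tendsto (fun T : ℝ => -Real.cos T * W T / T) atTop (𝓝 0) := by
    refine squeeze_zero_norm' (a := fun T => C * T⁻¹) ?_ (by simpa using tendsto_inv_atTop_zero.const_mul C)
    filter_upwards [eventually_gt_atTop 0] with T hT
    rw [norm_div, norm_mul, norm_neg, Real.norm_of_nonneg hT.le, div_eq_mul_inv]
    gcongr
    calc _ ≤ 1 * C := by gcongr; exacts [Real.abs_cos_le_one T, hb T]
      _ = C := one_mul _
  have hsW : ∀ a b : ℝ, IntervalIntegrable (fun t => Real.sinc t * W t) volume a b := fun a b =>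
    (Real.continuous_sinc.mul hW).intervalIntegrable _ _
  refine ⟨_, ((hV.add hlim).const_add ((∫ t in (0 : ℝ)..1, Real.sinc t * W t) + Real.cos 1 * W 1)).congr' ?_⟩
  filter_upwards [eventually_gt_atTop 1] with T hT
  rw [← integral_add_adjacent_intervals (hsW 0 1) (hsW 1 T)]
  have hqT : IntervalIntegrable q volume 1 T :=
    (intervalIntegrable_iff_integrableOn_Ioc_of_le hT.le).2 (hqi.mono_set Set.Ioc_subset_Ioi_self)
  have hFTC : ∫ t in (1 : ℝ)..T, (Real.sinc t * W t - q t) = -Real.cos T * W T / T - -Real.cos 1 * W 1 / 1 := by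
    refine integral_eq_sub_of_hasDerivAt (f := fun t => -Real.cos t * W t / t) (fun t ht => ?_) ((hsW 1 T).sub hqT)
    rw [Set.uIcc_of_le hT.le] at ht
    have ht0 : (0 : ℝ) < t := lt_of_lt_of_le one_pos ht.1
    have h1 := ((Real.hasDerivAt_cos t).neg.mul (hd t ht0).hasDerivAt).div (hasDerivAt_id t) ht0.ne'
    refine h1.congr_deriv ?_
    simp only [hq, Real.sinc_of_ne_zero ht0.ne', Pi.mul_apply, Pi.neg_apply, id]
    field_simp
    ring
  rw [integral_sub (hsW 1 T) hqT] at hFTC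
  simp only [id]
  linarith

lemma exists_tendsto_sineIntegral_atTop : ∃ L, Tendsto sineIntegral atTop (𝓝 L) := by
  obtain ⟨L, hL⟩ := exists_tendsto_integral_sinc_mul (W := fun _ => 1) (C := 1) continuous_const
    (by simp) (by simp) (fun t ht => by simp [ht.le])
  simp only [mul_one] at hL
  exact ⟨L, hL⟩

lemma exists_abs_sineIntegral_le : ∃ C, ∀ x, |sineIntegral x| ≤ C := by
  obtain ⟨L, hL⟩ := exists_tendsto_sineIntegral_atTop
  obtain ⟨T, hT⟩ := (eventually_atTop.1 ((hL.abs).eventually_le_const (lt_add_one |L|)))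
  obtain ⟨C, hC⟩ := (isCompact_Icc (a := (0 : ℝ)) (b := max T 0)).exists_bound_of_continuousOn
    continuous_sineIntegral.continuousOn
  have hpos : ∀ x, 0 ≤ x → |sineIntegral x| ≤ max (|L| + 1) C := fun x hx => by
    by_cases h : T ≤ x
    · exact (hT x h).trans (le_max_left _ _)
    · exact (hC x ⟨hx, (not_le.1 h).le.trans (le_max_left _ _)⟩).trans (le_max_right _ _)
  refine ⟨max (|L| + 1) C, fun x => ?_⟩
  rcases le_total 0 x with h | h
  · exact hpos x h
  · rw [← abs_neg, ← sineIntegral_neg]; exact hpos (-x) (by linarith)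

lemma exists_tendsto_sineIntegral_mul (a : ℝ) :
    ∃ L, Tendsto (fun N : ℕ => sineIntegral ((2 * N + 1) * Real.pi * a)) atTop (𝓝 L) := by
  obtain ⟨L, hL⟩ := exists_tendsto_sineIntegral_atTop
  have hpos : ∀ a : ℝ, 0 < a →
      Tendsto (fun N : ℕ => sineIntegral ((2 * N + 1) * Real.pi * a)) atTop (𝓝 L) := fun a ha => by
    refine hL.comp (Tendsto.atTop_mul_const ha (Tendsto.atTop_mul_const Real.pi_pos
      (tendsto_atTop_add_const_right _ _ ?_)))
    exact tendsto_natCast_atTop_atTop.const_mul_atTop (by norm_num)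
  rcases lt_trichotomy a 0 with h | h | h
  · refine ⟨-L, (hpos (-a) (by linarith)).neg.congr fun N => ?_⟩
    rw [mul_neg, sineIntegral_neg, neg_neg]
  · exact ⟨0, by simp [h]⟩
  · exact ⟨L, hpos a h⟩

/-- The product `∏ Si(at)` over a list of dilations `a`. -/
noncomputable def sineIntegralProd (l : List ℝ) (t : ℝ) : ℝ :=
  (l.map fun a => sineIntegral (a * t)).prod

@[simp] lemma sineIntegralProd_nil (t : ℝ) : sineIntegralProd [] t = 1 := rfl

lemma sineIntegralProd_cons (a : ℝ) (l : List ℝ) (t : ℝ) :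
    sineIntegralProd (a :: l) t = sineIntegral (a * t) * sineIntegralProd l t := by
  simp [sineIntegralProd]

lemma sineIntegralProd_neg (l : List ℝ) (t : ℝ) :
    sineIntegralProd l (-t) = sineIntegralProd (l.map fun a => -a) t := by
  simp [sineIntegralProd, Function.comp_def]

@[fun_prop] lemma continuous_sineIntegralProd (l : List ℝ) : Continuous (sineIntegralProd l) := by
  induction l with
  | nil => exact continuous_const
  | cons a l ih =>
    have : sineIntegralProd (a :: l) = fun t => sineIntegral (a * t) * sineIntegralProd l t :=
      funext fun t => sineIntegralProd_cons a l t
    rw [this]; fun_prop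

lemma exists_abs_sineIntegralProd_le (l : List ℝ) : ∃ C, ∀ t, |sineIntegralProd l t| ≤ C := by
  induction l with
  | nil => exact ⟨1, by simp⟩
  | cons a l ih =>
    obtain ⟨C, hC⟩ := ih
    obtain ⟨K, hK⟩ := exists_abs_sineIntegral_le
    refine ⟨K * C, fun t => ?_⟩
    rw [sineIntegralProd_cons, abs_mul]
    exact mul_le_mul (hK _) (hC t) (abs_nonneg _) ((abs_nonneg _).trans (hK 0))

/-- The derivative of Si(at) is sin(at)/t for a ≠ 0, hence at most 1/t in modulus for every
dilation; the product rule and the boundedness of Si do the rest. -/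
lemma exists_deriv_sineIntegralProd_le (l : List ℝ) :
    ∃ C, ∀ t, 0 < t → DifferentiableAt ℝ (sineIntegralProd l) t ∧
      |deriv (sineIntegralProd l) t| ≤ C / t := by
  induction l with
  | nil =>
    have : sineIntegralProd [] = fun _ => 1 := rfl
    exact ⟨0, fun t ht => by simp [this]⟩
  | cons a l ih =>
    obtain ⟨C, hC⟩ := ih
    obtain ⟨K, hK⟩ := exists_abs_sineIntegral_le
    obtain ⟨D, hD⟩ := exists_abs_sineIntegralProd_le l
    have : sineIntegralProd (a :: l) = fun t => sineIntegral (a * t) * sineIntegralProd l t :=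
      funext fun t => sineIntegralProd_cons a l t
    refine ⟨1 * D + K * C, fun t ht => ?_⟩
    have h1 : HasDerivAt (fun t => sineIntegral (a * t)) (Real.sinc (a * t) * a) t := by
      have := (hasDerivAt_sineIntegral (a * t)).comp t ((hasDerivAt_id t).const_mul a)
      simpa [Function.comp_def] using this
    have h2 := h1.mul (hC t ht).1.hasDerivAt
    have h3 : |Real.sinc (a * t) * a| ≤ 1 / t := by
      by_cases ha : a = 0
      · simp [ha, ht.le]
      · rw [Real.sinc_of_ne_zero (mul_ne_zero ha ht.ne'), div_mul_eq_mul_div, mul_comm a t,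
          mul_div_mul_right _ _ ha, abs_div, abs_of_pos ht]
        gcongr
        exact Real.abs_sin_le_one _
    rw [this]
    refine ⟨h2.differentiableAt, ?_⟩
    have h4 := h2.deriv
    rw [show (fun t => sineIntegral (a * t) * sineIntegralProd l t)
      = (fun t => sineIntegral (a * t)) * sineIntegralProd l from rfl, h4]
    refine (abs_add_le _ _).trans ?_
    rw [abs_mul, abs_mul (sineIntegral _), add_div, mul_div_right_comm, mul_div_assoc]
    have hK0 : 0 ≤ K := (abs_nonneg _).trans (hK 0)
    gcongr
    · exact hD t
    · exact hK _
    · exact (hC t ht).2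

/-- The half-line t < 0 reflects to t > 0 with every dilation a replaced by −a, so one-sided
convergence for all lists is enough. -/
lemma exists_tendsto_integral_sinc_mul_sineIntegralProd (l : List ℝ) :
    ∃ L, Tendsto (fun T : ℝ => ∫ t in (-T)..T, Real.sinc t * sineIntegralProd l t) atTop (𝓝 L) := by
  have key : ∀ l : List ℝ, ∃ L,
      Tendsto (fun T : ℝ => ∫ t in (0 : ℝ)..T, Real.sinc t * sineIntegralProd l t) atTop (𝓝 L) := by
    intro l
    obtain ⟨C, hC⟩ := exists_abs_sineIntegralProd_le l
    obtain ⟨D, hD⟩ := exists_deriv_sineIntegralProd_le l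
    refine exists_tendsto_integral_sinc_mul (C := max C D) (by fun_prop)
      (fun t => (hC t).trans (le_max_left _ _)) (fun t ht => (hD t ht).1)
      (fun t ht => (hD t ht).2.trans ?_)
    gcongr
    exact le_max_right _ _
  obtain ⟨L₁, h₁⟩ := key l
  obtain ⟨L₂, h₂⟩ := key (l.map fun a => -a)
  refine ⟨L₂ + L₁, (h₂.add h₁).congr fun T => ?_⟩
  have hc : Continuous fun t => Real.sinc t * sineIntegralProd l t :=
    Real.continuous_sinc.mul (by fun_prop)
  rw [← integral_add_adjacent_intervals (hc.intervalIntegrable (-T) 0) (hc.intervalIntegrable 0 T)]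
  congr 1
  have := intervalIntegral.integral_comp_neg (a := 0) (b := T)
    (fun t => Real.sinc t * sineIntegralProd l t)
  simp only [Real.sinc_neg, neg_zero, sineIntegralProd_neg] at this
  exact this

/-! ### The Dirichlet kernel against products of sine integrals -/

/-- The difference `1 / sin(πy) - 1 / (πy)`. -/
noncomputable def cscRemainder (y : ℝ) : ℝ := (Real.sin (Real.pi * y))⁻¹ - (Real.pi * y)⁻¹

@[fun_prop] lemma measurable_cscRemainder : Measurable cscRemainder := by
  unfold cscRemainder; fun_prop

lemma abs_cscRemainder_le {y : ℝ} (hy : |y| ≤ 1 / 2) : |cscRemainder y| ≤ Real.pi / 2 := by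
  have key : ∀ s : ℝ, 0 < s → s ≤ Real.pi / 2 → |(Real.sin s)⁻¹ - s⁻¹| ≤ Real.pi / 2 := by
    intro s hs hs2
    have h1 : 2 / Real.pi * s ≤ Real.sin s := Real.mul_le_sin hs.le hs2
    have h2 : Real.sin s ≤ s := Real.sin_le hs.le
    have hpi := Real.pi_pos
    have hsin : 0 < Real.sin s := lt_of_lt_of_le (by positivity) h1
    -- With this, the difference (s − sin s)/(s sin s) is at most s/sin s, which Jordan's inequality
    -- bounds by π/2.
    have h3 : s - Real.sin s ≤ s ^ 2 := by
      by_cases h : s ≤ 1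
      · have := Real.sin_gt_sub_cube hs
        nlinarith [mul_nonneg hs.le hs.le]
      · nlinarith
    have h4 : (Real.sin s)⁻¹ - s⁻¹ = (s - Real.sin s) / (Real.sin s * s) := by
      field_simp
    rw [h4, abs_of_nonneg (div_nonneg (by linarith) (by positivity)), div_le_iff₀ (by positivity)]
    have h5 : s ≤ Real.pi / 2 * Real.sin s := by
      calc s = Real.pi / 2 * (2 / Real.pi * s) := by field_simp
        _ ≤ _ := by gcongr
    nlinarith
  have hpi := Real.pi_pos
  rcases lt_trichotomy y 0 with h | h | h
  · rw [abs_of_neg h] at hy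
    have := key (Real.pi * -y) (by nlinarith) (by nlinarith)
    rw [mul_neg, Real.sin_neg, inv_neg, inv_neg] at this
    rw [cscRemainder, ← abs_neg]
    convert this using 2
    ring
  · simp [cscRemainder, h]
    positivity
  · rw [abs_of_pos h] at hy
    exact key _ (by positivity) (by nlinarith)

lemma dirichletKernel_eq_sinc_add (N : ℕ) {y : ℝ} (hy : |y| ≤ 1 / 2) (h0 : y ≠ 0) :
    dirichletKernel N y = (((2 * N + 1) * Real.sinc ((2 * N + 1) * Real.pi * y) : ℝ) : ℂ)
      + ((Real.sin ((2 * N + 1) * Real.pi * y) : ℝ) : ℂ) * (cscRemainder y : ℝ) := by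
  have hs := sin_pi_mul_ne_zero hy h0
  have hs' : ((Real.sin (Real.pi * y) : ℝ) : ℂ) ≠ 0 := by exact_mod_cast hs
  have hM : (2 * (N : ℝ) + 1) ≠ 0 := by positivity
  have hpi := Real.pi_ne_zero
  rw [eq_div_of_mul_eq hs' (dirichletKernel_mul_sin N y), ← Complex.ofReal_div,
    ← Complex.ofReal_mul, ← Complex.ofReal_add, Complex.ofReal_inj,
    Real.sinc_of_ne_zero (by positivity), cscRemainder]
  field_simp
  ring

lemma integral_mul_sinc_comp_mul (N : ℕ) (F : ℝ → ℝ) (a b : ℝ) :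
    ∫ t in a..b, (2 * N + 1) * F ((2 * N + 1) * Real.pi * t)
      = (∫ t in ((2 * N + 1) * Real.pi * a)..((2 * N + 1) * Real.pi * b), F t) / Real.pi := by
  have hM : (2 * (N : ℝ) + 1) ≠ 0 := by positivity
  have hpi := Real.pi_ne_zero
  rw [intervalIntegral.integral_const_mul, intervalIntegral.integral_comp_mul_left _ (by positivity),
    smul_eq_mul]
  field_simp

lemma ae_ne_zero : ∀ᵐ y : ℝ, y ≠ 0 := by simp [ae_iff]

lemma abs_le_of_mem_uIoc {h y : ℝ} (hy : y ∈ Set.uIoc 0 h) : |y| ≤ |h| := by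
  rcases le_total 0 h with h0 | h0
  · rw [Set.uIoc_of_le h0] at hy
    rw [abs_of_pos hy.1, abs_of_nonneg h0]; exact hy.2
  · rw [Set.uIoc_of_ge h0] at hy
    rw [abs_of_nonpos hy.2, abs_of_nonpos h0]; linarith [hy.1]

lemma exists_tendsto_sineIntegralProd (l : List ℝ) (y : ℝ) :
    ∃ L, Tendsto (fun N : ℕ => sineIntegralProd l ((2 * N + 1) * Real.pi * y)) atTop (𝓝 L) := by
  induction l with
  | nil => exact ⟨1, tendsto_const_nhds⟩
  | cons a l ih =>
    obtain ⟨L, hL⟩ := ih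
    obtain ⟨L', hL'⟩ := exists_tendsto_sineIntegral_mul (a * y)
    refine ⟨L' * L, (hL'.mul hL).congr fun N => ?_⟩
    rw [sineIntegralProd_cons]
    congr 2; ring

/-- Replacing 1/sin(πy) by 1/(πy) costs a bounded factor times an oscillating sine, which
Riemann–Lebesgue removes. The substitution t = (2N+1)πy turns the rest into (1/π) ∫ sinc(t) ∏ Si(at)
dt over a growing symmetric interval. -/
lemma exists_tendsto_integral_dirichletKernel_mul_sineIntegralProd (l : List ℝ) :
    ∃ L, Tendsto (fun N : ℕ => ∫ y in (-(1 / 2) : ℝ)..(1 / 2),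
      dirichletKernel N y * (sineIntegralProd l ((2 * N + 1) * Real.pi * y) : ℝ)) atTop (𝓝 L) := by
  obtain ⟨L, hL⟩ := exists_tendsto_integral_sinc_mul_sineIntegralProd l
  obtain ⟨C, hC⟩ := exists_abs_sineIntegralProd_le l
  have hle : (-(1 / 2) : ℝ) ≤ 1 / 2 := by norm_num
  have hmem : ∀ y : ℝ, y ∈ Set.uIoc (-(1 / 2) : ℝ) (1 / 2) → |y| ≤ 1 / 2 := fun y hy => by
    rw [Set.uIoc_of_le hle] at hy
    exact abs_le.2 ⟨hy.1.le, hy.2⟩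
  have hbd : ∀ (N : ℕ) (y : ℝ), y ∈ Set.uIoc (-(1 / 2) : ℝ) (1 / 2) →
      ‖((cscRemainder y * sineIntegralProd l ((2 * N + 1) * Real.pi * y) : ℝ) : ℂ)‖
        ≤ Real.pi / 2 * C := fun N y hy => by
    rw [Complex.norm_real, norm_mul]
    exact mul_le_mul (abs_cscRemainder_le (hmem y hy)) (hC _) (abs_nonneg _) (by positivity)
  have hmeas : ∀ N : ℕ, Measurable
      fun y : ℝ => ((cscRemainder y * sineIntegralProd l ((2 * N + 1) * Real.pi * y) : ℝ) : ℂ) :=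
    fun N => by
      have := (continuous_sineIntegralProd l).measurable
      fun_prop
  have h2 := tendsto_integral_sin_mul_of_dominated
    (h := fun (N : ℕ) y => ((cscRemainder y * sineIntegralProd l ((2 * N + 1) * Real.pi * y) : ℝ) : ℂ))
    (Φ := fun _ => Real.pi / 2 * C) hle (_root_.intervalIntegrable_const)
    (fun N => (hmeas N).aestronglyMeasurable) (fun N => Eventually.of_forall (hbd N)) (by
      refine Eventually.of_forall fun y _ => ?_
      obtain ⟨K, hK⟩ := exists_tendsto_sineIntegralProd l y
      exact ⟨_, (Complex.continuous_ofReal.tendsto _).comp (hK.const_mul (cscRemainder y))⟩)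
  have hlimT : Tendsto (fun N : ℕ => (2 * (N : ℝ) + 1) * Real.pi * (1 / 2)) atTop atTop := by
    refine Tendsto.atTop_mul_const (by norm_num) (Tendsto.atTop_mul_const Real.pi_pos
      (tendsto_atTop_add_const_right _ _ ?_))
    exact tendsto_natCast_atTop_atTop.const_mul_atTop (by norm_num)
  have h1 := (Complex.continuous_ofReal.tendsto _).comp ((hL.comp hlimT).div_const Real.pi)
  refine ⟨_, (h1.add h2).congr fun N => ?_⟩
  have e1 := integral_mul_sinc_comp_mul N (fun t => Real.sinc t * sineIntegralProd l t) (-(1 / 2)) (1 / 2)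
  simp only [Function.comp]
  rw [← mul_neg, ← e1, ← intervalIntegral.integral_ofReal, ← intervalIntegral.integral_add]
  · refine intervalIntegral.integral_congr_ae ?_
    filter_upwards [ae_ne_zero] with y hy hy2
    rw [dirichletKernel_eq_sinc_add N (hmem y hy2) hy]
    push_cast
    ring
  · have := Real.continuous_sinc
    exact Continuous.intervalIntegrable (by fun_prop) _ _
  · refine IntervalIntegrable.continuousOn_mul ?_ (Continuous.continuousOn (by fun_prop))
    refine (_root_.intervalIntegrable_const (c := Real.pi / 2 * C)).mono_fun (hmeas N).aestronglyMeasurable ?_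
    rw [EventuallyLE, ae_restrict_iff' measurableSet_uIoc]
    exact Eventually.of_forall fun y hy => (hbd N y hy).trans (le_abs_self _)

/-! ### Partial sums of the sawtooth -/

/-- The Fourier coefficients of the sawtooth `{x} - 1/2`. -/
noncomputable def sawtoothCoef (n : ℤ) : ℂ := -(2 * Real.pi * Complex.I * n)⁻¹

lemma hasDerivAt_trigSum_sawtoothCoef (N : ℕ) (x : ℝ) :
    HasDerivAt (trigSum sawtoothCoef N) (1 - dirichletKernel N x) x := by
  refine (hasDerivAt_trigSum sawtoothCoef N x).congr_deriv ?_
  have h : ∀ n : ℤ, 2 * Real.pi * Complex.I * n * sawtoothCoef n = (if n = 0 then 1 else 0) - 1 := by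
    intro n
    split_ifs with hn
    · simp [hn]
    · rw [sawtoothCoef, mul_neg, mul_inv_cancel₀]
      · simp
      · simp [hn, Real.pi_ne_zero]
  unfold dirichletKernel trigSum
  simp_rw [h, sub_mul, ite_mul, zero_mul, one_mul]
  rw [Finset.sum_sub_distrib, Finset.sum_ite_eq']
  simp

lemma trigSum_sawtoothCoef_zero (N : ℕ) : trigSum sawtoothCoef N 0 = 0 := by
  induction N with
  -- The convention 0⁻¹ = 0 gives the sawtooth mean value 0.
  | zero => simp [trigSum_zero_order, sawtoothCoef]
  | succ N ih =>
    rw [trigSum_succ, ih]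
    simp only [sawtoothCoef, mul_zero, neg_zero, expChar_zero]
    push_cast
    rw [mul_neg, inv_neg]
    ring

lemma trigSum_sawtoothCoef_add (N : ℕ) (x h : ℝ) :
    trigSum sawtoothCoef N (x + h) - trigSum sawtoothCoef N x
      = ∫ t in x..x + h, (1 - dirichletKernel N t) :=
  (integral_eq_sub_of_hasDerivAt (fun t _ => hasDerivAt_trigSum_sawtoothCoef N t)
    (Continuous.intervalIntegrable (by fun_prop) _ _)).symm

lemma intervalIntegrable_cscRemainder {h : ℝ} (hh : |h| ≤ 1 / 2) :
    IntervalIntegrable (fun y => (cscRemainder y : ℂ)) volume 0 h := by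
  refine (_root_.intervalIntegrable_const (c := Real.pi / 2)).mono_fun
    (by fun_prop : Measurable fun y => (cscRemainder y : ℂ)).aestronglyMeasurable ?_
  rw [EventuallyLE, ae_restrict_iff' measurableSet_uIoc]
  refine Eventually.of_forall fun y hy => ?_
  rw [Complex.norm_real]
  exact (abs_cscRemainder_le ((abs_le_of_mem_uIoc hy).trans hh)).trans (le_abs_self _)

/-- The partial sum is the integral of 1 − D_N from 0, and the sinc part of D_N integrates to Si/π.
-/
lemma trigSum_sawtoothCoef_eq (N : ℕ) {h : ℝ} (hh : |h| ≤ 1 / 2) :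
    trigSum sawtoothCoef N h = h - (sineIntegral ((2 * N + 1) * Real.pi * h) / Real.pi : ℝ)
      - ∫ t in (0 : ℝ)..h, ((Real.sin ((2 * N + 1) * Real.pi * t) : ℝ) : ℂ) * (cscRemainder t : ℝ) := by
  have h1 := trigSum_sawtoothCoef_add N 0 h
  rw [zero_add, trigSum_sawtoothCoef_zero, sub_zero] at h1
  have e1 := integral_mul_sinc_comp_mul N Real.sinc 0 h
  rw [mul_zero] at e1
  rw [h1, sineIntegral, ← e1, ← intervalIntegral.integral_ofReal, sub_sub, ← intervalIntegral.integral_add,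
    intervalIntegral.integral_sub]
  · congr 1
    · simp
    · refine intervalIntegral.integral_congr_ae ?_
      filter_upwards [ae_ne_zero] with y hy hy2
      exact dirichletKernel_eq_sinc_add N ((abs_le_of_mem_uIoc hy2).trans hh) hy
  · exact _root_.intervalIntegrable_const
  · exact Continuous.intervalIntegrable (by fun_prop) _ _
  · have := Real.continuous_sinc
    exact Continuous.intervalIntegrable (by fun_prop) _ _
  · exact (intervalIntegrable_cscRemainder hh).continuousOn_mul (Continuous.continuousOn (by fun_prop))

lemma norm_trigSum_sawtoothCoef_add_sineIntegral_le (N : ℕ) {h : ℝ} (hh : |h| ≤ 1 / 2) :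
    ‖trigSum sawtoothCoef N h + (sineIntegral ((2 * N + 1) * Real.pi * h) / Real.pi : ℝ)‖
      ≤ (1 + Real.pi / 2) * |h| := by
  rw [trigSum_sawtoothCoef_eq N hh]
  have h1 : ‖∫ t in (0 : ℝ)..h, ((Real.sin ((2 * N + 1) * Real.pi * t) : ℝ) : ℂ) *
      (cscRemainder t : ℝ)‖ ≤ Real.pi / 2 * |h - 0| := by
    refine norm_integral_le_of_norm_le_const fun t ht => ?_
    rw [norm_mul, Complex.norm_real, Complex.norm_real]
    calc _ ≤ 1 * (Real.pi / 2) := by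
          gcongr
          · exact Real.abs_sin_le_one _
          · exact abs_cscRemainder_le ((abs_le_of_mem_uIoc ht).trans hh)
      _ = _ := one_mul _
  rw [sub_zero] at h1
  have e : ∀ a b c : ℂ, a - b - c + b = a - c := fun a b c => by ring
  rw [e]
  refine (norm_sub_le _ _).trans ?_
  rw [Complex.norm_real, Real.norm_eq_abs]
  linarith

lemma trigSum_fract (c : ℤ → ℂ) (N : ℕ) (x : ℝ) : trigSum c N (x - round x) = trigSum c N x := by
  have := trigSum_add_int c N (x - round x) (round x)
  rwa [sub_add_cancel, eq_comm] at this

lemma exists_norm_trigSum_sawtoothCoef_le : ∃ C, ∀ N x, ‖trigSum sawtoothCoef N x‖ ≤ C := by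
  obtain ⟨K, hK⟩ := exists_abs_sineIntegral_le
  refine ⟨(1 + Real.pi / 2) * (1 / 2) + K / Real.pi, fun N x => ?_⟩
  have hx := abs_sub_round x
  rw [← trigSum_fract]
  set y := x - round x
  have h1 := norm_trigSum_sawtoothCoef_add_sineIntegral_le N hx
  have h2 : ‖((sineIntegral ((2 * N + 1) * Real.pi * y) / Real.pi : ℝ) : ℂ)‖ ≤ K / Real.pi := by
    rw [Complex.norm_real, norm_div, Real.norm_of_nonneg Real.pi_pos.le]
    have := Real.pi_pos
    gcongr
    exact hK _
  have h3 := norm_le_add_norm_add (trigSum sawtoothCoef N y)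
    ((sineIntegral ((2 * N + 1) * Real.pi * y) / Real.pi : ℝ) : ℂ)
  have h4 : (1 + Real.pi / 2) * |y| ≤ (1 + Real.pi / 2) * (1 / 2) := by
    have := Real.pi_pos
    gcongr
  linarith

lemma exists_tendsto_trigSum_sawtoothCoef (x : ℝ) :
    ∃ L, Tendsto (fun N => trigSum sawtoothCoef N x) atTop (𝓝 L) := by
  have hx := abs_sub_round x
  simp_rw [← trigSum_fract _ _ x]
  set y := x - round x
  obtain ⟨S, hS⟩ := exists_tendsto_sineIntegral_mul y
  have hI : Tendsto (fun N : ℕ => ∫ t in (0 : ℝ)..y, ((Real.sin ((2 * N + 1) * Real.pi * t) : ℝ) : ℂ) *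
      (cscRemainder t : ℝ)) atTop (𝓝 0) := by
    rcases le_total 0 y with h | h
    · exact tendsto_integral_sin_mul h (intervalIntegrable_cscRemainder hx)
    · have := (tendsto_integral_sin_mul h (intervalIntegrable_cscRemainder hx).symm).neg
      rw [neg_zero] at this
      exact this.congr fun N => (integral_symm _ _).symm
  refine ⟨_, ((((Complex.continuous_ofReal.tendsto _).comp (hS.div_const Real.pi)).const_sub
    (y : ℂ)).sub hI).congr fun N => ?_⟩
  rw [trigSum_sawtoothCoef_eq N hx]
  rfl

/-- A uniformly bounded family that is `O(|h|)` near `0` is `O(|h|^{1/4})` everywhere. -/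
lemma exists_norm_le_rpow {F : ℕ → ℝ → ℂ} {K K' δ : ℝ} (hδ : 0 < δ) (hδ1 : δ ≤ 1)
    (hK : ∀ N h, ‖F N h‖ ≤ K) (hK' : ∀ N h, |h| ≤ δ → ‖F N h‖ ≤ K' * |h|) :
    ∃ C, ∀ N h, ‖F N h‖ ≤ C * |h| ^ (1 / 4 : ℝ) := by
  have hK0 : 0 ≤ K := (norm_nonneg _).trans (hK 0 0)
  have hK'0 : 0 ≤ K' := by
    have := (norm_nonneg _).trans (hK' 0 δ (abs_of_pos hδ).le)
    rw [abs_of_pos hδ] at this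
    exact nonneg_of_mul_nonneg_left this hδ
  refine ⟨K / δ ^ (1 / 4 : ℝ) + K', fun N h => ?_⟩
  have hp : 0 ≤ |h| ^ (1 / 4 : ℝ) := by positivity
  have hd : 0 < δ ^ (1 / 4 : ℝ) := by positivity
  rw [add_mul]
  by_cases hh : |h| ≤ δ
  · have h1 : |h| ≤ |h| ^ (1 / 4 : ℝ) := by
      have := Real.rpow_le_rpow_of_exponent_ge_of_imp (abs_nonneg h) (hh.trans hδ1)
        (show (1 / 4 : ℝ) ≤ 1 by norm_num) (by norm_num)
      rwa [Real.rpow_one] at this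
    have h2 : K' * |h| ≤ K' * |h| ^ (1 / 4 : ℝ) := by gcongr
    have h3 : 0 ≤ K / δ ^ (1 / 4 : ℝ) * |h| ^ (1 / 4 : ℝ) := by positivity
    linarith [hK' N h hh]
  · have h1 : δ ^ (1 / 4 : ℝ) ≤ |h| ^ (1 / 4 : ℝ) := by
      have := (not_le.1 hh).le
      gcongr
    have h2 : K ≤ K / δ ^ (1 / 4 : ℝ) * |h| ^ (1 / 4 : ℝ) := by
      rw [div_mul_eq_mul_div, le_div_iff₀ hd]
      gcongr
    have h3 : 0 ≤ K' * |h| ^ (1 / 4 : ℝ) := by positivity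
    linarith [hK N h]

lemma norm_dirichletKernel_le (N : ℕ) {x c : ℝ} (hc : 0 < c) (hx : c ≤ |Real.sin (Real.pi * x)|) :
    ‖dirichletKernel N x‖ ≤ 1 / c := by
  have h := congrArg norm (dirichletKernel_mul_sin N x)
  rw [norm_mul, Complex.norm_real, Complex.norm_real, Real.norm_eq_abs, Real.norm_eq_abs] at h
  rw [le_div_iff₀ hc]
  calc _ ≤ ‖dirichletKernel N x‖ * |Real.sin (Real.pi * x)| := by gcongr
    _ ≤ 1 := by rw [h]; exact Real.abs_sin_le_one _

/-- Local expansion of the partial sums of the sawtooth around any point. -/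
lemma exists_sawtooth_expansion (x : ℝ) : ∃ (σ : ℂ) (C : ℝ), ∀ (N : ℕ) (h : ℝ),
    ‖trigSum sawtoothCoef N (x + h) - trigSum sawtoothCoef N x
      - σ * (sineIntegral ((2 * N + 1) * Real.pi * h) : ℝ)‖ ≤ C * |h| ^ (1 / 4 : ℝ) := by
  obtain ⟨B, hB⟩ := exists_norm_trigSum_sawtoothCoef_le
  obtain ⟨K, hK⟩ := exists_abs_sineIntegral_le
  have hbd : ∀ (σ : ℂ) (N : ℕ) (h : ℝ), ‖trigSum sawtoothCoef N (x + h) - trigSum sawtoothCoef N x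
      - σ * (sineIntegral ((2 * N + 1) * Real.pi * h) : ℝ)‖ ≤ (B + B) + ‖σ‖ * K := fun σ N h => by
    refine (norm_sub_le _ _).trans (add_le_add ((norm_sub_le _ _).trans (add_le_add (hB _ _) (hB _ _))) ?_)
    rw [norm_mul, Complex.norm_real]
    gcongr
    exact hK _
  -- At an integer the Gibbs term appears with σ = −1/π. Elsewhere D_N is bounded near x uniformly
  -- in N, so the partial sums are uniformly Lipschitz there and σ = 0.
  by_cases hx : Real.sin (Real.pi * x) = 0
  · obtain ⟨m, hm⟩ := Real.sin_eq_zero_iff.1 hx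
    have hxm : x = m := by
      have : Real.pi * (x - m) = 0 := by linarith
      rcases mul_eq_zero.1 this with h | h
      · exact absurd h Real.pi_ne_zero
      · linarith
    refine ⟨-(1 / Real.pi : ℝ), exists_norm_le_rpow (δ := 1 / 2) (by norm_num) (by norm_num) (hbd _)
      (K' := 1 + Real.pi / 2) fun N h hh => ?_⟩
    have := norm_trigSum_sawtoothCoef_add_sineIntegral_le N hh
    rw [hxm, add_comm (m : ℝ), trigSum_add_int, trigSum_intCast, trigSum_sawtoothCoef_zero]
    convert this using 2
    push_cast
    ring
  · set c := |Real.sin (Real.pi * x)| / 2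
    have hc : 0 < c := by have := abs_pos.2 hx; positivity
    have hcont : Continuous fun t : ℝ => |Real.sin (Real.pi * t)| := by fun_prop
    have hev : ∀ᶠ t in 𝓝 x, c < |Real.sin (Real.pi * t)| :=
      hcont.continuousAt.eventually_const_lt (by have := abs_pos.2 hx; simp only [c]; linarith)
    obtain ⟨ε, hε, hball⟩ := Metric.eventually_nhds_iff.1 hev
    refine ⟨0, exists_norm_le_rpow (δ := min (ε / 2) 1) (by positivity) (min_le_right _ _) (hbd 0)
      (K' := 1 + 1 / c) fun N h hh => ?_⟩
    rw [zero_mul, sub_zero, trigSum_sawtoothCoef_add]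
    have hh2 : |h| < ε := by have := hh.trans (min_le_left _ _); linarith
    have := norm_integral_le_of_norm_le_const (a := x) (b := x + h) (C := 1 + 1 / c)
      (f := fun t => 1 - dirichletKernel N t) fun t ht => ?_
    · simpa using this
    · refine (norm_sub_le _ _).trans (add_le_add (by simp) (norm_dirichletKernel_le N hc (hball ?_).le))
      rw [Real.dist_eq]
      refine lt_of_le_of_lt ?_ hh2
      have h1 := Set.uIoc_subset_uIcc ht
      have h2 := Set.abs_sub_left_of_mem_uIcc h1
      simpa using h2

/-! ### Tame coefficient sequences -/

/-- Interpolates between the Lipschitz bound 2π|t| for small t and the trivial bound 2 for large t.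
-/
lemma norm_expChar_sub_one_le (t : ℝ) : ‖expChar t - 1‖ ≤ 2 * Real.pi * |t| ^ (1 / 4 : ℝ) := by
  have hpi := Real.pi_gt_three
  have h1 : ‖expChar t - 1‖ ≤ 2 * Real.pi * |t| := by
    have := Real.norm_exp_I_mul_ofReal_sub_one_le (x := 2 * Real.pi * t)
    rw [Real.norm_eq_abs, abs_mul, abs_of_pos (by positivity : 0 < 2 * Real.pi)] at this
    convert this using 3
    rw [expChar]; congr 1; push_cast; ring
  have h2 : ‖expChar t - 1‖ ≤ 2 := by
    refine (norm_sub_le _ _).trans ?_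
    rw [norm_expChar, norm_one]; norm_num
  rcases le_total |t| 1 with h | h
  · have h3 : |t| ≤ |t| ^ (1 / 4 : ℝ) := by
      have := Real.rpow_le_rpow_of_exponent_ge_of_imp (abs_nonneg t) h
        (show (1 / 4 : ℝ) ≤ 1 by norm_num) (by norm_num)
      rwa [Real.rpow_one] at this
    exact h1.trans (by gcongr)
  · have h3 : 1 ≤ |t| ^ (1 / 4 : ℝ) := Real.one_le_rpow h (by norm_num)
    nlinarith

lemma norm_trigSum_le {d : ℤ → ℂ} (hd : Summable fun n => ‖d n‖) (N : ℕ) (x : ℝ) :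
    ‖trigSum d N x‖ ≤ ∑' n, ‖d n‖ := by
  refine (norm_sum_le _ _).trans ?_
  simp only [norm_mul, norm_expChar, mul_one]
  exact hd.sum_le_tsum _ fun _ _ => norm_nonneg _

lemma exists_tendsto_trigSum {d : ℤ → ℂ} (hd : Summable fun n => ‖d n‖) (x : ℝ) :
    ∃ L, Tendsto (fun N => trigSum d N x) atTop (𝓝 L) := by
  have hs : Summable fun n : ℤ => d n * expChar (n * x) :=
    Summable.of_norm (by simpa using hd)
  exact ⟨_, hs.hasSum.comp Finset.tendsto_Icc_neg⟩

lemma norm_trigSum_add_sub_le {d : ℤ → ℂ}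
    (hd : Summable fun n : ℤ => ‖d n‖ * |(n : ℝ)| ^ (1 / 4 : ℝ)) (N : ℕ) (x h : ℝ) :
    ‖trigSum d N (x + h) - trigSum d N x‖
      ≤ (2 * Real.pi * ∑' n : ℤ, ‖d n‖ * |(n : ℝ)| ^ (1 / 4 : ℝ)) * |h| ^ (1 / 4 : ℝ) := by
  unfold trigSum
  rw [← Finset.sum_sub_distrib]
  refine (norm_sum_le _ _).trans ?_
  have h1 : ∀ n : ℤ, ‖d n * expChar (n * (x + h)) - d n * expChar (n * x)‖
      ≤ (2 * Real.pi * |h| ^ (1 / 4 : ℝ)) * (‖d n‖ * |(n : ℝ)| ^ (1 / 4 : ℝ)) := by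
    intro n
    have e : d n * expChar (n * (x + h)) - d n * expChar (n * x)
        = d n * (expChar (n * x) * (expChar (n * h) - 1)) := by
      rw [mul_add, expChar_add]; ring
    rw [e, norm_mul, norm_mul, norm_expChar, one_mul]
    have h2 := norm_expChar_sub_one_le (n * h)
    rw [abs_mul, Real.mul_rpow (abs_nonneg _) (abs_nonneg _)] at h2
    calc _ ≤ ‖d n‖ * (2 * Real.pi * (|(n : ℝ)| ^ (1 / 4 : ℝ) * |h| ^ (1 / 4 : ℝ))) := by gcongr
      _ = _ := by ring
  refine (Finset.sum_le_sum fun n _ => h1 n).trans ?_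
  rw [← Finset.mul_sum]
  have h2 := hd.sum_le_tsum (Finset.Icc (-(N : ℤ)) (N : ℤ)) fun _ _ => by positivity
  have hpi := Real.pi_pos
  calc _ ≤ (2 * Real.pi * |h| ^ (1 / 4 : ℝ)) * ∑' n : ℤ, ‖d n‖ * |(n : ℝ)| ^ (1 / 4 : ℝ) := by gcongr
    _ = _ := by ring

/-- Coefficient sequences that are a multiple of those of the sawtooth plus the coefficients of a
function which is Hölder continuous of exponent `1/4`. -/
def IsTame (c : ℤ → ℂ) : Prop :=
  ∃ (β : ℂ) (d : ℤ → ℂ), (∀ n, c n = β * sawtoothCoef n + d n) ∧ (Summable fun n => ‖d n‖) ∧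
    Summable fun n : ℤ => ‖d n‖ * |(n : ℝ)| ^ (1 / 4 : ℝ)

lemma trigSum_eq_of_forall {c b d : ℤ → ℂ} {β : ℂ} (h : ∀ n, c n = β * b n + d n) (N : ℕ) (x : ℝ) :
    trigSum c N x = β * trigSum b N x + trigSum d N x := by
  unfold trigSum
  rw [Finset.mul_sum, ← Finset.sum_add_distrib]
  exact Finset.sum_congr rfl fun n _ => by rw [h]; ring

namespace IsTame

lemma exists_norm_le {c : ℤ → ℂ} (hc : IsTame c) : ∃ C, ∀ N x, ‖trigSum c N x‖ ≤ C := by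
  obtain ⟨β, d, h, hd, -⟩ := hc
  obtain ⟨B, hB⟩ := exists_norm_trigSum_sawtoothCoef_le
  refine ⟨‖β‖ * B + ∑' n, ‖d n‖, fun N x => ?_⟩
  rw [trigSum_eq_of_forall h]
  refine (norm_add_le _ _).trans (add_le_add ?_ (norm_trigSum_le hd N x))
  rw [norm_mul]
  gcongr
  exact hB N x

lemma exists_tendsto {c : ℤ → ℂ} (hc : IsTame c) (x : ℝ) :
    ∃ L, Tendsto (fun N => trigSum c N x) atTop (𝓝 L) := by
  obtain ⟨β, d, h, hd, -⟩ := hc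
  obtain ⟨L₁, h₁⟩ := exists_tendsto_trigSum_sawtoothCoef x
  obtain ⟨L₂, h₂⟩ := exists_tendsto_trigSum hd x
  exact ⟨_, ((h₁.const_mul β).add h₂).congr fun N => (trigSum_eq_of_forall h N x).symm⟩

/-- Only the sawtooth component produces a sine integral; the component d is Hölder uniformly in N
and goes into the error. -/
lemma exists_expansion {c : ℤ → ℂ} (hc : IsTame c) (x : ℝ) : ∃ (σ : ℂ) (C : ℝ), ∀ (N : ℕ) (h : ℝ),
    ‖trigSum c N (x + h) - trigSum c N x - σ * (sineIntegral ((2 * N + 1) * Real.pi * h) : ℝ)‖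
      ≤ C * |h| ^ (1 / 4 : ℝ) := by
  obtain ⟨β, d, hcd, -, hd⟩ := hc
  obtain ⟨σ, C, hC⟩ := exists_sawtooth_expansion x
  refine ⟨β * σ, ‖β‖ * C + 2 * Real.pi * ∑' n : ℤ, ‖d n‖ * |(n : ℝ)| ^ (1 / 4 : ℝ), fun N h => ?_⟩
  rw [trigSum_eq_of_forall hcd, trigSum_eq_of_forall hcd]
  have e : ∀ a b u v s : ℂ, β * a + u - (β * b + v) - β * σ * s = β * (a - b - σ * s) + (u - v) :=
    fun a b u v s => by ring
  rw [e, add_mul (‖β‖ * C)]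
  refine (norm_add_le _ _).trans (add_le_add ?_ (norm_trigSum_add_sub_le hd N x h))
  rw [norm_mul]
  exact (mul_le_mul_of_nonneg_left (hC N h) (norm_nonneg β)).trans_eq (mul_assoc _ _ _).symm

end IsTame

/-! ### Good sequences and existence of the principal values -/

/-- Uniformly bounded, almost everywhere convergent sequences of continuous functions whose products
with dilated sine integrals have convergent integrals against the Dirichlet kernels. -/
structure IsGood (g : ℕ → ℝ → ℂ) : Prop where
  continuous : ∀ N, Continuous (g N)
  bounded : ∃ C, ∀ N y, ‖g N y‖ ≤ C
  tendsto : ∀ᵐ y, ∃ L, Tendsto (fun N => g N y) atTop (𝓝 L)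
  integral : ∀ l : List ℝ, ∃ L, Tendsto (fun N : ℕ => ∫ y in (-(1 / 2) : ℝ)..(1 / 2),
    dirichletKernel N y * (g N y * (sineIntegralProd l ((2 * N + 1) * Real.pi * y) : ℝ))) atTop (𝓝 L)

lemma isGood_one : IsGood fun _ _ => 1 where
  continuous _ := continuous_const
  bounded := ⟨1, by simp⟩
  tendsto := Eventually.of_forall fun _ => ⟨1, tendsto_const_nhds⟩
  integral l := by
    simpa using exists_tendsto_integral_dirichletKernel_mul_sineIntegralProd l

/-- Expand the new factor around x. The constant term reuses the hypothesis for the list l, the sine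
integral term reuses it for a :: l, and the O(|y|^{1/4}) error integrates to 0 in the limit. This is
why the integral condition quantifies over all lists. -/
lemma IsGood.mul_trigSum {g : ℕ → ℝ → ℂ} (hg : IsGood g) {c : ℤ → ℂ} (hc : IsTame c) (x a : ℝ) :
    IsGood fun N y => g N y * trigSum c N (x + a * y) where
  continuous N := (hg.continuous N).mul (by fun_prop)
  bounded := by
    obtain ⟨C, hC⟩ := hg.bounded
    obtain ⟨D, hD⟩ := hc.exists_norm_le
    refine ⟨C * D, fun N y => ?_⟩
    rw [norm_mul]
    exact mul_le_mul (hC N y) (hD _ _) (norm_nonneg _) ((norm_nonneg _).trans (hC N y))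
  tendsto := by
    filter_upwards [hg.tendsto] with y ⟨L, hL⟩
    obtain ⟨L', hL'⟩ := hc.exists_tendsto (x + a * y)
    exact ⟨_, hL.mul hL'⟩
  integral l := by
    obtain ⟨C, hC⟩ := hg.bounded
    obtain ⟨σ, D, hD⟩ := hc.exists_expansion x
    obtain ⟨K, hK⟩ := exists_abs_sineIntegralProd_le l
    obtain ⟨L₀, h₀⟩ := hc.exists_tendsto x
    obtain ⟨L₁, h₁⟩ := hg.integral l
    obtain ⟨L₂, h₂⟩ := hg.integral (a :: l)
    have hcg := hg.continuous
    set E : ℕ → ℝ → ℂ := fun N y => trigSum c N (x + a * y) - trigSum c N x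
      - σ * (sineIntegral ((2 * N + 1) * Real.pi * (a * y)) : ℝ) with hE
    have hcE : ∀ N, Continuous (E N) := fun N => by simp only [hE]; fun_prop
    have h₃ := tendsto_integral_dirichletKernel_mul (C := C * (D * |a| ^ (1 / 4 : ℝ)) * K)
      (g := fun N y => g N y * E N y * (sineIntegralProd l ((2 * N + 1) * Real.pi * y) : ℝ))
      (fun N => Continuous.aestronglyMeasurable (by fun_prop)) (fun N y _ => by
        rw [norm_mul, norm_mul, Complex.norm_real]
        have h1 := hD N (a * y)
        rw [abs_mul, Real.mul_rpow (abs_nonneg _) (abs_nonneg _)] at h1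
        have hC0 : 0 ≤ C := (norm_nonneg _).trans (hC 0 0)
        calc _ ≤ C * (D * (|a| ^ (1 / 4 : ℝ) * |y| ^ (1 / 4 : ℝ))) * K := by
              gcongr
              · exact mul_nonneg hC0 ((norm_nonneg _).trans h1)
              · exact hC N y
              · exact hK _
          _ = _ := by ring) (by
        filter_upwards [hg.tendsto] with y ⟨L, hL⟩
        obtain ⟨S, hS⟩ := hc.exists_tendsto (x + a * y)
        obtain ⟨T, hT⟩ := exists_tendsto_sineIntegral_mul (a * y)
        obtain ⟨U, hU⟩ := exists_tendsto_sineIntegralProd l y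
        exact ⟨_, (hL.mul ((hS.sub h₀).sub
          (((Complex.continuous_ofReal.tendsto _).comp hT).const_mul σ))).mul
            ((Complex.continuous_ofReal.tendsto _).comp hU)⟩)
    refine ⟨_, (((h₀.mul h₁).add (h₂.const_mul σ)).add h₃).congr fun N => ?_⟩
    rw [← intervalIntegral.integral_const_mul, ← intervalIntegral.integral_const_mul,
      ← intervalIntegral.integral_add, ← intervalIntegral.integral_add]
    · congr 1
      ext y
      rw [sineIntegralProd_cons, show a * ((2 * N + 1) * Real.pi * y)
        = (2 * N + 1) * Real.pi * (a * y) by ring]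
      simp only [hE]
      push_cast
      ring
    all_goals exact Continuous.intervalIntegrable (by fun_prop) _ _

lemma isGood_prod {ι : Type*} (s : Finset ι) {c : ι → ℤ → ℂ} (hc : ∀ j, IsTame (c j)) (x a : ι → ℝ) :
    IsGood fun N y => ∏ j ∈ s, trigSum (c j) N (x j + a j * y) := by
  classical
  induction s using Finset.induction_on with
  | empty => simpa using isGood_one
  | insert j s hj ih =>
    have := ih.mul_trigSum (hc j) (x j) (a j)
    convert this using 3 with N y
    rw [Finset.prod_insert hj, mul_comm]

/-- After y = mx the integrand has period m, since each ν_j is an integer; a full period splits into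
m unit windows centred at 0, …, m − 1, each carrying one peak of the kernel. -/
lemma integral_dirichletKernel_mul_prod {ι : Type*} (s : Finset ι) (c : ι → ℤ → ℂ) (ν : ι → ℕ)
    {m : ℕ} (hm : 0 < m) (N : ℕ) :
    m * ∫ x in (0 : ℝ)..1, dirichletKernel N (m * x) * ∏ j ∈ s, trigSum (c j) N (ν j * x)
      = ∑ i ∈ Finset.range m, ∫ y in (-(1 / 2) : ℝ)..(1 / 2), dirichletKernel N y *
          ∏ j ∈ s, trigSum (c j) N (i * ν j / m + ν j / m * y) := by
  set H : ℝ → ℂ := fun y => dirichletKernel N y * ∏ j ∈ s, trigSum (c j) N (ν j / m * y) with hH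
  have hm0 : (m : ℝ) ≠ 0 := by exact_mod_cast hm.ne'
  have hHc : Continuous H := by simp only [hH]; fun_prop
  have hper : Function.Periodic H (m : ℝ) := fun y => by
    simp only [hH, dirichletKernel]
    congr 1
    · exact_mod_cast trigSum_add_int _ N y m
    · refine Finset.prod_congr rfl fun j _ => ?_
      have := trigSum_add_int (c j) N (ν j / m * y) (ν j)
      rw [← this]
      congr 1
      push_cast
      field_simp
  have h1 : ∫ x in (0 : ℝ)..1, dirichletKernel N (m * x) * ∏ j ∈ s, trigSum (c j) N (ν j * x)
      = ∫ x in (0 : ℝ)..1, H (m * x) := by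
    congr 1
    ext x
    simp only [hH]
    congr 1
    refine Finset.prod_congr rfl fun j _ => ?_
    congr 1
    field_simp
  rw [h1, intervalIntegral.integral_comp_mul_left _ hm0, mul_zero, mul_one]
  have h2 := hper.intervalIntegral_add_eq 0 (-(1 / 2))
  rw [zero_add] at h2
  have h3 := sum_integral_adjacent_intervals (μ := volume) (f := H) (a := fun i : ℕ => (i : ℝ) - 1 / 2) (n := m)
    fun i _ => hHc.intervalIntegrable _ _
  have h4 : (m : ℂ) * ((m : ℝ)⁻¹ • ∫ x in (0 : ℝ)..m, H x) = ∫ x in (0 : ℝ)..m, H x := by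
    rw [Complex.real_smul]
    push_cast
    rw [← mul_assoc, mul_inv_cancel₀ (by exact_mod_cast hm.ne'), one_mul]
  rw [h4, h2, show (-(1 / 2) : ℝ) + m = m - 1 / 2 by ring,
    show (-(1 / 2) : ℝ) = ((0 : ℕ) : ℝ) - 1 / 2 by norm_num, ← h3]
  refine Finset.sum_congr rfl fun i _ => ?_
  have h5 := intervalIntegral.integral_comp_add_right (a := -(1 / 2)) (b := 1 / 2) H (i : ℝ)
  rw [show (-(1 / 2) : ℝ) + i = (i : ℝ) - 1 / 2 by ring,
    show (1 / 2 : ℝ) + i = ((i + 1 : ℕ) : ℝ) - 1 / 2 by push_cast; ring] at h5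
  rw [← h5, show (((0 : ℕ) : ℝ) - 1 / 2) = -(1 / 2) by norm_num]
  congr 1
  ext y
  simp only [hH]
  congr 1
  · simpa [dirichletKernel] using trigSum_add_int (fun _ => 1) N y i
  · refine Finset.prod_congr rfl fun j _ => ?_
    congr 1
    field_simp
    ring

lemma exists_hasPrincipalValue {r : ℕ} {f : Fin (r + 1) → ℝ → ℂ} {ν : Fin (r + 1) → ℕ}
    (hf : ∀ j, IsTame (fourierCoef (f j))) {k : Fin (r + 1)} (hν : 0 < ν k) :
    ∃ P, HasPrincipalValue (orthLattice ν) (fun n => (ν k : ℂ) * coefProd f k n) P := by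
  have h : ∀ i : ℕ, ∃ L, Tendsto (fun N => ∫ y in (-(1 / 2) : ℝ)..(1 / 2), dirichletKernel N y *
      ∏ j ∈ Finset.univ.erase k, trigSum (fourierCoef (f j)) N (i * ν j / ν k + ν j / ν k * y))
      atTop (𝓝 L) := fun i => by
    simpa using (isGood_prod (Finset.univ.erase k) hf (fun j => i * ν j / ν k)
      fun j => ν j / ν k).integral []
  choose L hL using h
  refine ⟨∑ i ∈ Finset.range (ν k), L i, ?_⟩
  refine (tendsto_finsetSum _ fun i _ => hL i).congr fun N => ?_
  rw [cubeSum_coefProd_eq_integral, integral_dirichletKernel_mul_prod _ _ _ hν]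

/-! ### Regularity and Fourier coefficients of functions of class 𝒮₁ -/

lemma measurable_of_continuousAt_off_countable {f : ℝ → ℂ} {S : Set ℝ} (hS : S.Countable)
    (hf : ∀ x, x ∉ S → ContinuousAt f x) : Measurable f := by
  refine measurable_of_isOpen fun U hU => ?_
  have hc : ContinuousOn f Sᶜ := fun x hx => (hf x hx).continuousWithinAt
  obtain ⟨V, hV, hVU⟩ := continuousOn_iff'.1 hc U hU
  have : f ⁻¹' U = (f ⁻¹' U ∩ S) ∪ (V ∩ Sᶜ) := by
    rw [← hVU, Set.inter_union_compl]
  rw [this]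
  exact (hS.mono Set.inter_subset_right).measurableSet.union
    (hV.measurableSet.inter hS.measurableSet.compl)

/-- Families of one interval suffice. Uniform continuity yields the one-sided limits at 0 and 1, and
from them boundedness. -/
lemma AbsContOn.uniformContinuousOn {f : ℝ → ℂ} {I : Set ℝ} (hf : AbsContOn f I) :
    UniformContinuousOn f I := by
  rw [Metric.uniformContinuousOn_iff]
  intro ε hε
  obtain ⟨δ, hδ, h⟩ := hf ε hε
  have key : ∀ x ∈ I, ∀ y ∈ I, x < y → dist x y < δ → dist (f x) (f y) < ε := by
    intro x hx y hy hxy hd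
    have := h 1 (fun _ => x) (fun _ => y) (fun _ => ⟨hx, hy, hxy⟩)
      (fun i j hij => absurd (Subsingleton.elim i j) hij) (by simpa [Real.dist_eq, abs_sub_comm] using hd)
    simpa [dist_eq_norm, norm_sub_rev] using this
  refine ⟨δ, hδ, fun x hx y hy hd => ?_⟩
  rcases lt_trichotomy x y with hxy | hxy | hxy
  · exact key x hx y hy hxy hd
  · simpa [hxy] using hε
  · rw [dist_comm] at hd ⊢
    exact key y hy x hx hxy hd

namespace IsS1

variable {f g : ℝ → ℂ}

lemma add_int (hf : IsS1 f) (x : ℝ) (m : ℤ) : f (x + m) = f x := by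
  have h : Function.Periodic f 1 := hf.periodic
  simpa using h.int_mul m x

lemma continuousAt_of_notMem (hf : IsS1 f) {x : ℝ} (hx : x ∉ Set.range ((↑) : ℤ → ℝ)) :
    ContinuousAt f x :=
  hf.continuousAt x fun m hm => hx ⟨m, hm.symm⟩

protected lemma measurable (hf : IsS1 f) : Measurable f :=
  measurable_of_continuousAt_off_countable (Set.countable_range _) fun _ => hf.continuousAt_of_notMem

lemma tendsto_nhdsGT_zero (hf : IsS1 f) : Tendsto f (𝓝[>] 0) (𝓝 (atZeroPlus f)) := by
  refine tendsto_nhds_limUnder (cauchy_iff_exists_le_nhds.1 (Cauchy.map_of_le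
    (cauchy_nhds.mono nhdsWithin_le_nhds) hf.absContOn.uniformContinuousOn ?_))
  exact le_principal_iff.2 (Ioo_mem_nhdsGT one_pos)

lemma tendsto_nhdsLT_one (hf : IsS1 f) : Tendsto f (𝓝[<] 1) (𝓝 (atOneMinus f)) := by
  refine tendsto_nhds_limUnder (cauchy_iff_exists_le_nhds.1 (Cauchy.map_of_le
    (cauchy_nhds.mono nhdsWithin_le_nhds) hf.absContOn.uniformContinuousOn ?_))
  exact le_principal_iff.2 (Ioo_mem_nhdsLT one_pos)

lemma exists_norm_le (hf : IsS1 f) : ∃ C, ∀ x, ‖f x‖ ≤ C := by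
  have hc : ContinuousOn f (Set.Ioo 0 1) := hf.absContOn.uniformContinuousOn.continuousOn
  obtain ⟨C, hC⟩ := (isCompact_Icc (a := (0 : ℝ)) (b := 1)).exists_bound_of_continuousOn
    (continuousOn_Icc_extendFrom_Ioo hc hf.tendsto_nhdsGT_zero hf.tendsto_nhdsLT_one)
  refine ⟨max C ‖f 0‖, fun x => ?_⟩
  have hx : f x = f (Int.fract x) := by
    have := hf.add_int (Int.fract x) ⌊x⌋
    rwa [Int.fract_add_floor] at this
  rw [hx]
  rcases (Int.fract_nonneg x).eq_or_lt with h0 | h0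
  · rw [← h0]; exact le_max_right _ _
  · have hmem : Int.fract x ∈ Set.Ioo (0 : ℝ) 1 := ⟨h0, Int.fract_lt_one x⟩
    have := hC _ (Set.Ioo_subset_Icc_self hmem)
    rw [extendFrom_eq (subset_closure hmem) (hc _ hmem)] at this
    exact this.trans (le_max_left _ _)

protected lemma intervalIntegrable (hf : IsS1 f) (a b : ℝ) : IntervalIntegrable f volume a b := by
  obtain ⟨C, hC⟩ := hf.exists_norm_le
  refine (_root_.intervalIntegrable_const (c := C)).mono_fun hf.measurable.aestronglyMeasurable ?_
  exact Eventually.of_forall fun x => (hC x).trans (le_abs_self _)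

end IsS1

lemma fourierCoef_eq (f : ℝ → ℂ) (n : ℤ) :
    fourierCoef f n = ∫ x in (0 : ℝ)..1, f x * expChar ((-n : ℤ) * x) := by
  unfold fourierCoef expChar
  congr 1; ext x; push_cast; rfl

/-- Integration by parts on (0,1): the character is 1 at both ends, so the boundary term is the
jump. -/
lemma IsS1.fourierCoef_deriv {f g : ℝ → ℂ} (hf : IsS1 f) (hg : IsS1 g)
    (hd : ∀ x : ℝ, (∀ m : ℤ, x ≠ m) → HasDerivAt f (g x) x) (n : ℤ) :
    2 * Real.pi * Complex.I * n * fourierCoef f n = fourierCoef g n - jump f := by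
  have he : Continuous fun x : ℝ => expChar ((-n : ℤ) * x) := by fun_prop
  have hif := (hf.intervalIntegrable 0 1).mul_continuousOn he.continuousOn
  have hig := (hg.intervalIntegrable 0 1).mul_continuousOn he.continuousOn
  have h := integral_eq_sub_of_hasDerivAt_of_tendsto (a := 0) (b := 1)
    (f := fun x => f x * expChar ((-n : ℤ) * x))
    (f' := fun x => g x * expChar ((-n : ℤ) * x)
      - 2 * Real.pi * Complex.I * n * (f x * expChar ((-n : ℤ) * x)))
    (fa := atZeroPlus f * 1) (fb := atOneMinus f * 1) one_pos (fun x hx => by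
      have hx' : ∀ m : ℤ, x ≠ m := fun m hm => by
        rw [hm] at hx
        have h1 : (0 : ℤ) < m := by exact_mod_cast hx.1
        have h2 : m < (1 : ℤ) := by exact_mod_cast hx.2
        omega
      refine ((hd x hx').mul (hasDerivAt_expChar_mul _ x)).congr_deriv ?_
      push_cast; ring) (hig.sub (hif.const_mul _))
    (hf.tendsto_nhdsGT_zero.mul (tendsto_nhdsWithin_of_tendsto_nhds
      (by simpa using he.tendsto 0)))
    (hf.tendsto_nhdsLT_one.mul (tendsto_nhdsWithin_of_tendsto_nhds
      (by simpa only [mul_one, expChar_intCast] using he.tendsto 1)))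
  rw [intervalIntegral.integral_sub hig (hif.const_mul _), intervalIntegral.integral_const_mul,
    ← fourierCoef_eq, ← fourierCoef_eq, mul_one, mul_one] at h
  rw [jump, ← h]
  ring

lemma fourierCoef_eq_fourierCoeffOn (f : ℝ → ℂ) (n : ℤ) :
    fourierCoef f n = fourierCoeffOn one_pos f n := by
  rw [fourierCoeffOn_eq_integral, fourierCoef_eq]
  simp only [sub_zero, div_one, one_smul]
  congr 1
  ext x
  have := fourier_coe_apply (T := 1 - 0) (n := -n) (x := x)
  rw [this, smul_eq_mul, mul_comm, expChar]
  congr 2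
  push_cast
  ring

lemma fourierCoef_trigSum (c : ℤ → ℂ) (N : ℕ) (m : ℤ) :
    fourierCoef (trigSum c N) m = if m ∈ Finset.Icc (-(N : ℤ)) (N : ℤ) then c m else 0 := by
  rw [fourierCoef_eq]
  have : ∀ x : ℝ, trigSum c N x * expChar ((-m : ℤ) * x)
      = ∑ n ∈ Finset.Icc (-(N : ℤ)) (N : ℤ), c n * expChar ((n - m : ℤ) * x) := fun x => by
    rw [trigSum, Finset.sum_mul]
    refine Finset.sum_congr rfl fun n _ => ?_
    rw [mul_assoc, ← expChar_add]
    congr 2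
    push_cast; ring
  simp_rw [this]
  rw [integral_finsetSum fun n _ => Continuous.intervalIntegrable (by fun_prop) _ _]
  simp_rw [intervalIntegral.integral_const_mul, integral_expChar_intCast_mul, sub_eq_zero]
  simp

/-! ### Convergence of Fourier series -/

namespace IsS1

variable {f g : ℝ → ℂ}

lemma hasSum_sq_fourierCoef {F : ℝ → ℂ} (hF : Measurable F) {C : ℝ} (hC : ∀ x, ‖F x‖ ≤ C) :
    HasSum (fun n => ‖fourierCoef F n‖ ^ 2) (∫ x in (0 : ℝ)..1, ‖F x‖ ^ 2) := by
  have := hasSum_sq_fourierCoeffOn (f := F) (a := 0) (b := 1) one_pos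
    (MemLp.of_bound hF.aestronglyMeasurable C (Eventually.of_forall hC))
  simpa [fourierCoef_eq_fourierCoeffOn] using this

lemma summable_sq_fourierCoef (hf : IsS1 f) : Summable fun n => ‖fourierCoef f n‖ ^ 2 := by
  obtain ⟨C, hC⟩ := hf.exists_norm_le
  exact (hasSum_sq_fourierCoef hf.measurable hC).summable

lemma exists_norm_trigSum_le (c : ℤ → ℂ) (N : ℕ) : ∃ C, ∀ x, ‖trigSum c N x‖ ≤ C :=
  ⟨∑ n ∈ Finset.Icc (-(N : ℤ)) (N : ℤ), ‖c n‖, fun x => (norm_sum_le _ _).trans_eq (by simp)⟩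

/-- The partial sums of the Fourier series converge in the mean. -/
lemma tendsto_integral_norm_trigSum_sub (hf : IsS1 f) :
    Tendsto (fun N => ∫ x in (0 : ℝ)..1, ‖trigSum (fourierCoef f) N x - f x‖) atTop (𝓝 0) := by
  obtain ⟨C, hC⟩ := hf.exists_norm_le
  have hfm := hf.measurable
  have hsum := hasSum_sq_fourierCoef hfm hC
  set F : ℕ → ℝ → ℂ := fun N x => trigSum (fourierCoef f) N x - f x
  have hFm : ∀ N, Measurable (F N) := fun N =>
    (continuous_trigSum _ N).measurable.sub hfm
  have hFb : ∀ N, ∃ D, ∀ x, ‖F N x‖ ≤ D := fun N => by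
    obtain ⟨D, hD⟩ := exists_norm_trigSum_le (fourierCoef f) N
    exact ⟨D + C, fun x => (norm_sub_le _ _).trans (add_le_add (hD x) (hC x))⟩
  -- The error has as coefficients the negated tail of those of f, so by Parseval its squared L²
  -- norm is the tail of a convergent series.
  have hcoef : ∀ N n, fourierCoef (F N) n
      = if n ∈ Finset.Icc (-(N : ℤ)) (N : ℤ) then 0 else -fourierCoef f n := fun N n => by
    have h1 : fourierCoef (F N) n = fourierCoef (trigSum (fourierCoef f) N) n - fourierCoef f n := by
      have he : Continuous fun x : ℝ => expChar ((-n : ℤ) * x) := by fun_prop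
      rw [fourierCoef_eq, fourierCoef_eq, fourierCoef_eq, ← intervalIntegral.integral_sub
        (Continuous.intervalIntegrable (by fun_prop) _ _)
        ((hf.intervalIntegrable 0 1).mul_continuousOn he.continuousOn)]
      congr 1; ext x; simp only [F]; ring
    rw [h1, fourierCoef_trigSum]
    split_ifs <;> simp
  have hsq : Tendsto (fun N => ∫ x in (0 : ℝ)..1, ‖F N x‖ ^ 2) atTop (𝓝 0) := by
    have h1 : ∀ N, ∫ x in (0 : ℝ)..1, ‖F N x‖ ^ 2 = (∫ x in (0 : ℝ)..1, ‖f x‖ ^ 2)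
        - ∑ n ∈ Finset.Icc (-(N : ℤ)) (N : ℤ), ‖fourierCoef f n‖ ^ 2 := fun N => by
      obtain ⟨D, hD⟩ := hFb N
      refine (hasSum_sq_fourierCoef (hFm N) hD).unique ?_
      have h2 : HasSum (fun n => if n ∈ Finset.Icc (-(N : ℤ)) (N : ℤ) then ‖fourierCoef f n‖ ^ 2 else 0)
          (∑ n ∈ Finset.Icc (-(N : ℤ)) (N : ℤ), ‖fourierCoef f n‖ ^ 2) := by
        rw [← Finset.sum_congr rfl fun n (hn : n ∈ Finset.Icc (-(N : ℤ)) (N : ℤ)) =>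
          if_pos (c := n ∈ Finset.Icc (-(N : ℤ)) (N : ℤ)) (t := ‖fourierCoef f n‖ ^ 2) (e := 0) hn]
        exact hasSum_sum_of_ne_finset_zero fun n hn => if_neg hn
      have h3 : (fun n => ‖fourierCoef (F N) n‖ ^ 2) = fun n => ‖fourierCoef f n‖ ^ 2
          - if n ∈ Finset.Icc (-(N : ℤ)) (N : ℤ) then ‖fourierCoef f n‖ ^ 2 else 0 := by
        ext n
        rw [hcoef]
        split_ifs <;> simp
      rw [h3]
      exact hsum.sub h2
    simp_rw [h1]
    have := (hsum.comp Finset.tendsto_Icc_neg).const_sub (∫ x in (0 : ℝ)..1, ‖f x‖ ^ 2)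
    rw [sub_self] at this
    exact this
  have hI1 : ∀ N, IntervalIntegrable (fun x => ‖F N x‖) volume 0 1 := fun N => by
    obtain ⟨D, hD⟩ := hFb N
    refine (_root_.intervalIntegrable_const (c := D)).mono_fun (hFm N).norm.aestronglyMeasurable ?_
    exact Eventually.of_forall fun x => by simpa using (hD x).trans (le_abs_self _)
  have hI2 : ∀ N, IntervalIntegrable (fun x => ‖F N x‖ ^ 2) volume 0 1 := fun N => by
    obtain ⟨D, hD⟩ := hFb N
    refine (_root_.intervalIntegrable_const (c := D ^ 2)).mono_fun
      ((hFm N).norm.pow_const 2).aestronglyMeasurable ?_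
    refine Eventually.of_forall fun x => ?_
    have := hD x
    simp only [norm_pow, norm_norm]
    gcongr
    exact this.trans (le_abs_self D)
  have hCS : ∀ N, ∫ x in (0 : ℝ)..1, ‖F N x‖ ≤ √(∫ x in (0 : ℝ)..1, ‖F N x‖ ^ 2) := fun N => by
    refine Real.le_sqrt_of_sq_le ?_
    set m := ∫ x in (0 : ℝ)..1, ‖F N x‖
    -- Cauchy–Schwarz on the unit interval, as nonnegativity of the variance of ‖F_N‖.
    have h0 : 0 ≤ ∫ x in (0 : ℝ)..1, (‖F N x‖ - m) ^ 2 :=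
      intervalIntegral.integral_nonneg zero_le_one fun x _ => sq_nonneg _
    have e : ∫ x in (0 : ℝ)..1, (‖F N x‖ - m) ^ 2
        = (∫ x in (0 : ℝ)..1, ‖F N x‖ ^ 2) - 2 * m * m + m ^ 2 := by
      have : ∀ x, (‖F N x‖ - m) ^ 2 = ‖F N x‖ ^ 2 - 2 * m * ‖F N x‖ + m ^ 2 := fun x => by ring
      simp_rw [this]
      rw [intervalIntegral.integral_add ((hI2 N).sub ((hI1 N).const_mul _))
        _root_.intervalIntegrable_const, intervalIntegral.integral_sub (hI2 N) ((hI1 N).const_mul _),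
        intervalIntegral.integral_const_mul]
      simp only [intervalIntegral.integral_const, sub_zero, one_smul]
      rfl
    nlinarith
  refine squeeze_zero (fun N => intervalIntegral.integral_nonneg zero_le_one fun x _ => norm_nonneg _) hCS ?_
  have := (Real.continuous_sqrt.tendsto _).comp hsq
  rwa [Real.sqrt_zero] at this

/-- Removing Δf times the sawtooth leaves d_n = c_n(f')/(2πi n) for n ≠ 0. With the weight |n|^{1/4}
this is dominated by the product of the ℓ² sequences c_n(f') and |n|^{-3/4}; any exponent in (0,
1/2) would serve in place of 1/4. -/
lemma isTame_fourierCoef (hf : IsS1 f) (hg : IsS1 g)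
    (hd : ∀ x : ℝ, (∀ m : ℤ, x ≠ m) → HasDerivAt f (g x) x) : IsTame (fourierCoef f) := by
  have hpi := Real.pi_gt_three
  set d : ℤ → ℂ := fun n => fourierCoef f n - jump f * sawtoothCoef n with hd_def
  have hnorm : ∀ n : ℤ, n ≠ 0 → ‖d n‖ ≤ ‖fourierCoef g n‖ * |(n : ℝ)|⁻¹ := fun n hn => by
    have hne : (2 * Real.pi * Complex.I * n : ℂ) ≠ 0 := by simp [hn, Real.pi_ne_zero]
    have h1 : d n = fourierCoef g n * (2 * Real.pi * Complex.I * n)⁻¹ := by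
      rw [← div_eq_mul_inv, eq_div_iff hne]
      have := hf.fourierCoef_deriv hg hd n
      simp only [hd_def, sawtoothCoef]
      rw [sub_mul, mul_comm (fourierCoef f n), this, mul_assoc (jump f), neg_mul, inv_mul_cancel₀ hne]
      ring
    rw [h1, norm_mul, norm_inv]
    have h2 : ‖(2 * Real.pi * Complex.I * n : ℂ)‖ = 2 * Real.pi * |(n : ℝ)| := by
      simp [abs_of_pos Real.pi_pos]
    have h3 : 0 < |(n : ℝ)| := by simpa using hn
    rw [h2]
    gcongr
    nlinarith
  have hS : Summable fun n : ℤ => ‖d n‖ * |(n : ℝ)| ^ (1 / 4 : ℝ) := by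
    have hb := hg.summable_sq_fourierCoef.add (Real.summable_abs_int_rpow (b := 3 / 2) (by norm_num))
    refine Summable.of_nonneg_of_le (fun n => by positivity) (fun n => ?_) hb
    by_cases hn : n = 0
    · simp only [hn, Int.cast_zero, abs_zero]
      rw [Real.zero_rpow (by norm_num), mul_zero]
      positivity
    · have h3 : 0 < |(n : ℝ)| := by simpa using hn
      have e1 : |(n : ℝ)|⁻¹ * |(n : ℝ)| ^ (1 / 4 : ℝ) = |(n : ℝ)| ^ (-(3 / 4) : ℝ) := by
        rw [← Real.rpow_neg_one, ← Real.rpow_add h3]; norm_num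
      have e2 : |(n : ℝ)| ^ (-(3 / 2) : ℝ) = (|(n : ℝ)| ^ (-(3 / 4) : ℝ)) ^ 2 := by
        rw [← Real.rpow_natCast, ← Real.rpow_mul h3.le]; norm_num
      calc ‖d n‖ * |(n : ℝ)| ^ (1 / 4 : ℝ)
          ≤ ‖fourierCoef g n‖ * |(n : ℝ)|⁻¹ * |(n : ℝ)| ^ (1 / 4 : ℝ) := by gcongr; exact hnorm n hn
        _ = ‖fourierCoef g n‖ * |(n : ℝ)| ^ (-(3 / 4) : ℝ) := by rw [mul_assoc, e1]
        _ ≤ _ := by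
          rw [e2]
          nlinarith [sq_nonneg (‖fourierCoef g n‖ - |(n : ℝ)| ^ (-(3 / 4) : ℝ)),
            sq_nonneg ‖fourierCoef g n‖, sq_nonneg (|(n : ℝ)| ^ (-(3 / 4) : ℝ))]
  refine ⟨jump f, d, fun n => by simp [hd_def], ?_, hS⟩
  refine Summable.of_nonneg_of_le (fun n => norm_nonneg _) (fun n => ?_)
    -- The weight |n|^{1/4} vanishes at n = 0, so the term ‖d 0‖ is added by hand.
    (hS.add (hasSum_ite_eq (0 : ℤ) ‖d 0‖).summable)
  by_cases hn : n = 0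
  · simp [hn]
  · simp only [hn, if_false, add_zero]
    refine le_mul_of_one_le_right (norm_nonneg _) (Real.one_le_rpow ?_ (by norm_num))
    exact_mod_cast Int.one_le_abs hn

/-- Pointwise convergence of the Fourier series at the points of differentiability. -/
lemma tendsto_trigSum_fourierCoef (hf : IsS1 f) {x : ℝ} {f' : ℂ} (hd : HasDerivAt f f' x) :
    Tendsto (fun N => trigSum (fourierCoef f) N x) atTop (𝓝 (f x)) := by
  obtain ⟨C, hC⟩ := hf.exists_norm_le
  have hfm := hf.measurable
  have hO := hd.isBigO_sub
  obtain ⟨K, hK⟩ := hO.bound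
  obtain ⟨ε, hε, hball⟩ := Metric.eventually_nhds_iff.1 hK
  -- Differentiability at x gives f(x − y) − f(x) = O(|y|), more than enough to tame the kernel.
  obtain ⟨D, hD⟩ := exists_norm_le_rpow (F := fun _ y => f (x - y) - f x) (K := C + C) (K' := K)
    (δ := min (ε / 2) 1) (by positivity) (min_le_right _ _)
    (fun _ y => (norm_sub_le _ _).trans (add_le_add (hC _) (hC _))) (fun _ y hy => by
      have hy2 : |y| < ε := by have := hy.trans (min_le_left _ _); linarith
      have := hball (y := x - y) (by simpa [Real.dist_eq] using hy2)
      simpa using this)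
  have key := tendsto_integral_dirichletKernel_mul (g := fun _ y => f (x - y) - f x) (C := D)
    (fun _ => by
      have : Measurable fun y => f (x - y) - f x := by fun_prop
      exact this.aestronglyMeasurable) (fun N y _ => hD N y)
    (Eventually.of_forall fun y => ⟨_, tendsto_const_nhds⟩)
  have h2 := key.add_const (f x)
  rw [zero_add] at h2
  refine h2.congr fun N => ?_
  have hD1 : ∫ y in (-(1 / 2) : ℝ)..(1 / 2), dirichletKernel N y = 1 := by
    have hp : Function.Periodic (dirichletKernel N) 1 := fun y => by
      simpa [dirichletKernel] using trigSum_add_int (fun _ => 1) N y 1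
    have h3 := hp.intervalIntegral_add_eq (-(1 / 2)) 0
    rw [zero_add, show (-(1 / 2) : ℝ) + 1 = 1 / 2 by norm_num] at h3
    rw [h3]
    unfold dirichletKernel trigSum
    rw [integral_finsetSum fun n _ => Continuous.intervalIntegrable (by fun_prop) _ _]
    simp_rw [one_mul, integral_expChar_intCast_mul]
    simp
  have hDf : ∀ a b, IntervalIntegrable (fun y => dirichletKernel N y * f (x - y)) volume a b :=
    fun a b => by
      refine IntervalIntegrable.continuousOn_mul ?_ (continuous_dirichletKernel N).continuousOn
      refine (_root_.intervalIntegrable_const (c := C)).mono_fun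
        (hfm.comp (measurable_const.sub measurable_id)).aestronglyMeasurable ?_
      exact Eventually.of_forall fun y => (hC _).trans (le_abs_self _)
  have h4 : ∫ y in (-(1 / 2) : ℝ)..(1 / 2), dirichletKernel N y * (f (x - y) - f x)
      = (∫ y in (-(1 / 2) : ℝ)..(1 / 2), dirichletKernel N y * f (x - y)) - f x := by
    simp_rw [mul_sub]
    rw [intervalIntegral.integral_sub (hDf _ _) (Continuous.intervalIntegrable (by fun_prop) _ _),
      intervalIntegral.integral_mul_const, hD1, one_mul]
  rw [h4, sub_add_cancel]
  have hper : Function.Periodic (fun t => dirichletKernel N (x - t) * f t) 1 := fun t => by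
    simp only
    rw [hf.periodic t]
    congr 1
    have := trigSum_add_int (fun _ => 1) N (x - (t + 1)) 1
    rw [dirichletKernel, dirichletKernel, ← this]
    congr 1
    push_cast; ring
  have h5 := intervalIntegral.integral_comp_sub_left (a := -(1 / 2)) (b := 1 / 2)
    (fun t => dirichletKernel N (x - t) * f t) x
  simp only [sub_sub_cancel] at h5
  have h6 := hper.intervalIntegral_add_eq (x - 1 / 2) 0
  rw [zero_add, show x - 1 / 2 + 1 = x - -(1 / 2) by ring] at h6
  rw [h5, h6]
  unfold dirichletKernel trigSum
  simp_rw [one_mul, Finset.sum_mul]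
  rw [intervalIntegral.integral_finsetSum]
  · refine Finset.sum_congr rfl fun n _ => ?_
    rw [fourierCoef_eq, ← intervalIntegral.integral_mul_const]
    congr 1
    ext t
    rw [mul_comm, mul_assoc, ← expChar_add]
    congr 2
    push_cast; ring
  · intro n _
    exact (hf.intervalIntegrable 0 1).continuousOn_mul (Continuous.continuousOn (by fun_prop))

end IsS1

/-! ### Integrals of piecewise smooth functions and limits of products -/

/-- The fundamental theorem of calculus for a function with finitely many jumps. -/
lemma integral_eq_sub_sub_sum_jumps {F G L R : ℝ → ℂ} {a : ℝ}
    (hL : ∀ x, Tendsto F (𝓝[<] x) (𝓝 (L x))) (hR : ∀ x, Tendsto F (𝓝[>] x) (𝓝 (R x)))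
    (hG : ∀ u v, IntervalIntegrable G volume u v) (P : Finset ℝ) :
    ∀ {b : ℝ}, a < b → (∀ p ∈ P, p ∈ Set.Ioo a b) →
      (∀ x ∈ Set.Ioo a b, x ∉ P → HasDerivAt F (G x) x) →
      ∫ x in a..b, G x = L b - R a - ∑ p ∈ P, (R p - L p) := by
  -- Cut at the largest jump: no jump lies to its right, and the induction hypothesis covers its
  -- left, which is why b varies.
  induction P using Finset.induction_on_max with
  | empty =>
    intro b hab _ hd
    rw [integral_eq_sub_of_hasDerivAt_of_tendsto hab (fun x hx => hd x hx (by simp)) (hG _ _) (hR a) (hL b)]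
    simp
  | insert p P hp ih =>
    intro b hab hP hd
    have hpm := hP p (Finset.mem_insert_self _ _)
    have h1 := ih hpm.1
      (fun q hq => ⟨(hP q (Finset.mem_insert_of_mem hq)).1, hp q hq⟩)
      (fun x hx hxP => hd x ⟨hx.1, hx.2.trans hpm.2⟩ (by
        rw [Finset.mem_insert, not_or]; exact ⟨hx.2.ne, hxP⟩))
    have h2 := integral_eq_sub_of_hasDerivAt_of_tendsto hpm.2 (f := F) (f' := G)
      (fun x hx => hd x ⟨hpm.1.trans hx.1, hx.2⟩ (by
        rw [Finset.mem_insert, not_or]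
        exact ⟨hx.1.ne', fun h => (hp x h).not_gt hx.1⟩)) (hG _ _) (hR p) (hL b)
    rw [← integral_add_adjacent_intervals (hG a p) (hG p b), h1, h2,
      Finset.sum_insert fun h => (hp p h).false]
    ring

/-- If `A_N → A` in the mean and `B_N → B` boundedly almost everywhere, then
`∫ A_N B_N → ∫ A B`. -/
lemma tendsto_integral_mul_of_mean {A B : ℕ → ℝ → ℂ} {a b : ℝ → ℂ} {C : ℝ}
    (hA : ∀ N, Continuous (A N)) (hB : ∀ N, Continuous (B N))
    (ha : IntervalIntegrable a volume 0 1)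
    (hAa : Tendsto (fun N => ∫ x in (0 : ℝ)..1, ‖A N x - a x‖) atTop (𝓝 0))
    (hBC : ∀ N x, ‖B N x‖ ≤ C) (hBb : ∀ᵐ x, Tendsto (fun N => B N x) atTop (𝓝 (b x))) :
    Tendsto (fun N => ∫ x in (0 : ℝ)..1, A N x * B N x) atTop (𝓝 (∫ x in (0 : ℝ)..1, a x * b x)) := by
  have h1 : Tendsto (fun N => ∫ x in (0 : ℝ)..1, (A N x - a x) * B N x) atTop (𝓝 0) := by
    refine squeeze_zero_norm (a := fun N => C * ∫ x in (0 : ℝ)..1, ‖A N x - a x‖) (fun N => ?_)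
      (by simpa using hAa.const_mul C)
    have hAi : IntervalIntegrable (fun x => A N x - a x) volume 0 1 :=
      ((hA N).intervalIntegrable _ _).sub ha
    rw [← intervalIntegral.integral_const_mul]
    refine (intervalIntegral.norm_integral_le_integral_norm zero_le_one).trans ?_
    refine integral_mono_on zero_le_one
      (hAi.mul_continuousOn (hB N).continuousOn).norm (hAi.norm.const_mul C) fun x _ => ?_
    rw [norm_mul, mul_comm]
    gcongr
    exact hBC N x
  have h2 : Tendsto (fun N => ∫ x in (0 : ℝ)..1, a x * B N x) atTop
      (𝓝 (∫ x in (0 : ℝ)..1, a x * b x)) := by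
    refine tendsto_integral_filter_of_dominated_convergence (fun x => ‖a x‖ * C)
      (Eventually.of_forall fun N => ?_) (Eventually.of_forall fun N => ?_) (ha.norm.mul_const C) ?_
    · rw [Set.uIoc_of_le zero_le_one]
      exact ha.1.aestronglyMeasurable.mul (hB N).aestronglyMeasurable
    · refine Eventually.of_forall fun x _ => ?_
      rw [norm_mul]
      gcongr
      exact hBC N x
    · filter_upwards [hBb] with x hx _ using hx.const_mul _
  have h3 := h1.add h2
  rw [zero_add] at h3
  refine h3.congr fun N => ?_
  rw [← intervalIntegral.integral_add]
  · congr 1; ext x; ring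
  · exact (((hA N).intervalIntegrable _ _).sub ha).mul_continuousOn (hB N).continuousOn
  · exact ha.mul_continuousOn (hB N).continuousOn

lemma integral_comp_natCast_mul_of_periodic {q : ℝ → ℝ} (hq : Function.Periodic q 1)
    (hi : ∀ u v, IntervalIntegrable q volume u v) {m : ℕ} (hm : 0 < m) :
    ∫ x in (0 : ℝ)..1, q (m * x) = ∫ x in (0 : ℝ)..1, q x := by
  have hm0 : (m : ℝ) ≠ 0 := by exact_mod_cast hm.ne'
  have h := hq.intervalIntegral_add_zsmul_eq m 0 hi
  rw [intervalIntegral.integral_comp_mul_left _ hm0, mul_zero, mul_one]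
  simp only [zero_add, zsmul_eq_mul, mul_one, Int.cast_natCast] at h
  rw [h, smul_eq_mul, ← mul_assoc, inv_mul_cancel₀ hm0, one_mul]

lemma countable_mul_mem_range {a : ℝ} (ha : a ≠ 0) :
    {x : ℝ | a * x ∈ Set.range ((↑) : ℤ → ℝ)}.Countable :=
  (Set.countable_range _).preimage (mul_right_injective₀ ha)

open Classical in
/-- The left limits of a function of class `𝒮₁`. -/
noncomputable def leftValue (f : ℝ → ℂ) (y : ℝ) : ℂ :=
  if y ∈ Set.range ((↑) : ℤ → ℝ) then atOneMinus f else f y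

open Classical in
/-- The right limits of a function of class `𝒮₁`. -/
noncomputable def rightValue (f : ℝ → ℂ) (y : ℝ) : ℂ :=
  if y ∈ Set.range ((↑) : ℤ → ℝ) then atZeroPlus f else f y

namespace IsS1

variable {f : ℝ → ℂ}

lemma tendsto_leftValue (hf : IsS1 f) (y : ℝ) : Tendsto f (𝓝[<] y) (𝓝 (leftValue f y)) := by
  unfold leftValue
  split_ifs with h
  · obtain ⟨m, rfl⟩ := h
    have hs : Tendsto (fun x : ℝ => x + (1 - m : ℤ)) (𝓝[<] (m : ℝ)) (𝓝[<] 1) := by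
      refine tendsto_nhdsWithin_iff.2 ⟨tendsto_nhdsWithin_of_tendsto_nhds ?_, ?_⟩
      · have : ContinuousAt (fun x : ℝ => x + (1 - m : ℤ)) (m : ℝ) := by fun_prop
        have h2 := this.tendsto
        push_cast at h2 ⊢
        simpa using h2
      · filter_upwards [self_mem_nhdsWithin] with x hx
        simp only [Set.mem_Iio] at hx ⊢
        push_cast; linarith
    exact (hf.tendsto_nhdsLT_one.comp hs).congr fun x => hf.add_int x _
  · exact (hf.continuousAt_of_notMem h).tendsto.mono_left nhdsWithin_le_nhds

lemma tendsto_rightValue (hf : IsS1 f) (y : ℝ) : Tendsto f (𝓝[>] y) (𝓝 (rightValue f y)) := by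
  unfold rightValue
  split_ifs with h
  · obtain ⟨m, rfl⟩ := h
    have hs : Tendsto (fun x : ℝ => x + (-m : ℤ)) (𝓝[>] (m : ℝ)) (𝓝[>] 0) := by
      refine tendsto_nhdsWithin_iff.2 ⟨tendsto_nhdsWithin_of_tendsto_nhds ?_, ?_⟩
      · have : ContinuousAt (fun x : ℝ => x + (-m : ℤ)) (m : ℝ) := by fun_prop
        have h2 := this.tendsto
        push_cast at h2 ⊢
        simpa using h2
      · filter_upwards [self_mem_nhdsWithin] with x hx
        simp only [Set.mem_Ioi] at hx ⊢
        push_cast; linarith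
    exact (hf.tendsto_nhdsGT_zero.comp hs).congr fun x => hf.add_int x _
  · exact (hf.continuousAt_of_notMem h).tendsto.mono_left nhdsWithin_le_nhds

end IsS1

lemma tendsto_const_mul_nhdsLT {a : ℝ} (ha : 0 < a) (x : ℝ) :
    Tendsto (fun x => a * x) (𝓝[<] x) (𝓝[<] (a * x)) := by
  refine tendsto_nhdsWithin_iff.2 ⟨tendsto_nhdsWithin_of_tendsto_nhds
    (continuous_const_mul a).continuousAt, ?_⟩
  filter_upwards [self_mem_nhdsWithin] with y hy
  exact mul_lt_mul_of_pos_left hy ha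

lemma tendsto_const_mul_nhdsGT {a : ℝ} (ha : 0 < a) (x : ℝ) :
    Tendsto (fun x => a * x) (𝓝[>] x) (𝓝[>] (a * x)) := by
  refine tendsto_nhdsWithin_iff.2 ⟨tendsto_nhdsWithin_of_tendsto_nhds
    (continuous_const_mul a).continuousAt, ?_⟩
  filter_upwards [self_mem_nhdsWithin] with y hy
  exact mul_lt_mul_of_pos_left hy ha

/-! ### The jumps of the product and the limit of the integrals -/

section Main

variable {r : ℕ} {f g : Fin (r + 1) → ℝ → ℂ} {ν : Fin (r + 1) → ℕ}

/-- The points `i / νₖ` with `0 < i < νₖ`. -/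
noncomputable def jumpPoint (ν : Fin (r + 1) → ℕ) (q : Σ _ : Fin (r + 1), ℕ) : ℝ := q.2 / ν q.1

/-- The index set of the jump points. -/
def jumpIndex (ν : Fin (r + 1) → ℕ) : Finset (Σ _ : Fin (r + 1), ℕ) :=
  Finset.univ.sigma fun k => Finset.Ico 1 (ν k)

/-- Otherwise ν_k divides ν_j i, hence divides i by coprimality, although 0 < i < ν_k. -/
lemma notMem_range_of_coprime {k j : Fin (r + 1)} (hcop : Nat.Coprime (ν k) (ν j)) {i : ℕ}
    (hi : i ∈ Finset.Ico 1 (ν k)) : (ν j : ℝ) * (i / ν k) ∉ Set.range ((↑) : ℤ → ℝ) := by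
  rw [Finset.mem_Ico] at hi
  rintro ⟨m, hm⟩
  have hk : (ν k : ℝ) ≠ 0 := by
    have : 0 < ν k := by omega
    exact_mod_cast this.ne'
  have h1 : (m * ν k : ℝ) = ν j * i := by rw [hm]; field_simp
  have h2 : m * (ν k : ℤ) = ν j * i := by exact_mod_cast h1
  have h3 : (ν k : ℤ) ∣ ((ν j * i : ℕ) : ℤ) := ⟨m, by push_cast; rw [← h2]; ring⟩
  have h4 := hcop.dvd_of_dvd_mul_left (Int.natCast_dvd_natCast.1 h3)
  exact absurd (Nat.le_of_dvd (by omega) h4) (by omega)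

/-- If i/ν_k = i'/ν_{k'} with k ≠ k', then ν_{k'} · (i/ν_k) would be the integer i'. -/
lemma injOn_jumpPoint (hcop : Pairwise fun i j => Nat.Coprime (ν i) (ν j)) :
    Set.InjOn (jumpPoint ν) (jumpIndex ν : Set (Σ _ : Fin (r + 1), ℕ)) := by
  rintro ⟨k, i⟩ hki ⟨k', i'⟩ hki' h
  simp only [jumpIndex, Finset.coe_sigma, Set.mem_sigma_iff, Finset.coe_univ, Set.mem_univ, true_and,
    Finset.mem_coe] at hki hki'
  simp only [jumpPoint] at h
  have hpos : ∀ {k i}, i ∈ Finset.Ico 1 (ν k) → (ν k : ℝ) ≠ 0 := fun {k i} hi => by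
    have : 0 < ν k := by rw [Finset.mem_Ico] at hi; omega
    exact_mod_cast this.ne'
  by_cases hk : k = k'
  · subst hk
    have := (div_left_inj' (hpos hki)).1 h
    simpa using this
  · refine absurd ⟨(i' : ℤ), ?_⟩ (notMem_range_of_coprime (hcop hk) hki)
    rw [h]
    have := hpos hki'
    push_cast
    field_simp

/-- Only the k-th argument is an integer, so the other factors are continuous there. The sign is
negative because crossing an integer takes f_k from f_k(1⁻) to f_k(0⁺). -/
lemma prod_values_sub {k : Fin (r + 1)} (hcop : Pairwise fun i j => Nat.Coprime (ν i) (ν j))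
    {i : ℕ} (hi : i ∈ Finset.Ico 1 (ν k)) :
    ∏ j, rightValue (f j) (ν j * (i / ν k)) - ∏ j, leftValue (f j) (ν j * (i / ν k))
      = -((∏ j ∈ Finset.univ.erase k, f j (i * ν j / ν k)) * jump (f k)) := by
  have hk : (ν k : ℝ) ≠ 0 := by
    have : 0 < ν k := by rw [Finset.mem_Ico] at hi; omega
    exact_mod_cast this.ne'
  have hkm : (ν k : ℝ) * (i / ν k) ∈ Set.range ((↑) : ℤ → ℝ) := ⟨i, by push_cast; field_simp⟩
  rw [← Finset.mul_prod_erase _ _ (Finset.mem_univ k), ← Finset.mul_prod_erase _ _ (Finset.mem_univ k)]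
  have hj : ∀ j ∈ Finset.univ.erase k, rightValue (f j) (ν j * (i / ν k)) = f j (i * ν j / ν k) ∧
      leftValue (f j) (ν j * (i / ν k)) = f j (i * ν j / ν k) := fun j hj => by
    have h := notMem_range_of_coprime (hcop (Finset.ne_of_mem_erase hj).symm) hi
    rw [rightValue, leftValue, if_neg h, if_neg h, mul_div_assoc', mul_comm (ν j : ℝ)]
    exact ⟨rfl, rfl⟩
  rw [Finset.prod_congr rfl fun j h => (hj j h).1, Finset.prod_congr rfl fun j h => (hj j h).2,
    rightValue, leftValue, if_pos hkm, if_pos hkm, jump]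
  ring

lemma IsS1.intervalIntegrable_mul_prod (hf : ∀ k, IsS1 (f k)) {h : ℝ → ℂ} (hh : IsS1 h)
    (k : Fin (r + 1)) (u v : ℝ) :
    IntervalIntegrable (fun x => ν k * (h (ν k * x) * ∏ j ∈ Finset.univ.erase k, f j (ν j * x)))
      volume u v := by
  choose C hC using fun k => (hf k).exists_norm_le
  obtain ⟨D, hD⟩ := hh.exists_norm_le
  have hm : Measurable fun x => ν k * (h (ν k * x) * ∏ j ∈ Finset.univ.erase k, f j (ν j * x)) := by
    have h1 := hh.measurable
    have h2 := fun j => (hf j).measurable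
    fun_prop
  refine (_root_.intervalIntegrable_const (c := ν k * (D * ∏ j ∈ Finset.univ.erase k, C j))).mono_fun
    hm.aestronglyMeasurable (Eventually.of_forall fun x => ?_)
  refine le_trans ?_ (le_abs_self _)
  simp only [norm_mul, norm_prod, Complex.norm_natCast]
  gcongr
  · exact (norm_nonneg _).trans (hD 0)
  · exact hD _
  · exact hC _ _

lemma sum_integral_deriv_prod (hf : ∀ k, IsS1 (f k)) (hg : ∀ k, IsS1 (g k))
    (hd : ∀ k, ∀ x : ℝ, (∀ m : ℤ, x ≠ m) → HasDerivAt (f k) (g k x) x) (hpos : ∀ k, 0 < ν k)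
    (hcop : Pairwise fun i j => Nat.Coprime (ν i) (ν j)) :
    ∑ k, ∫ x in (0 : ℝ)..1, ν k * (g k (ν k * x) * ∏ j ∈ Finset.univ.erase k, f j (ν j * x))
      = vectorJump f + reciprocity f ν := by
  have hpos' : ∀ k, (0 : ℝ) < ν k := fun k => by exact_mod_cast hpos k
  have hint := fun k u v => IsS1.intervalIntegrable_mul_prod (ν := ν) hf (hg k) k u v
  rw [← intervalIntegral.integral_finsetSum fun k _ => hint k 0 1,
    integral_eq_sub_sub_sum_jumps (F := fun x => ∏ j, f j (ν j * x))
      (L := fun x => ∏ j, leftValue (f j) (ν j * x)) (R := fun x => ∏ j, rightValue (f j) (ν j * x))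
      (fun x => tendsto_finsetProd _ fun j _ =>
        ((hf j).tendsto_leftValue _).comp (tendsto_const_mul_nhdsLT (hpos' j) x))
      (fun x => tendsto_finsetProd _ fun j _ =>
        ((hf j).tendsto_rightValue _).comp (tendsto_const_mul_nhdsGT (hpos' j) x))
      (fun u v => by
        simpa [Finset.sum_fn] using IntervalIntegrable.sum Finset.univ fun k _ => hint k u v)
      ((jumpIndex ν).image (jumpPoint ν)) one_pos ?_ ?_,
    Finset.sum_image (injOn_jumpPoint hcop), jumpIndex, Finset.sum_sigma]
  · have h1 : ∏ j, leftValue (f j) (ν j * 1) = ∏ j, atOneMinus (f j) :=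
      Finset.prod_congr rfl fun j _ => if_pos ⟨ν j, by simp⟩
    have h0 : ∏ j, rightValue (f j) (ν j * 0) = ∏ j, atZeroPlus (f j) :=
      Finset.prod_congr rfl fun j _ => if_pos ⟨0, by simp⟩
    rw [h1, h0, vectorJump, sub_eq_add_neg _ (Finset.sum _ _), ← Finset.sum_neg_distrib, reciprocity]
    congr 1
    refine Finset.sum_congr rfl fun k _ => ?_
    rw [dedekindSum, Finset.sum_mul, ← Finset.sum_neg_distrib]
    refine Finset.sum_congr rfl fun i hi => ?_
    simp only [jumpPoint]
    rw [prod_values_sub hcop hi, neg_neg]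
  · intro p hp
    obtain ⟨⟨k, i⟩, hki, rfl⟩ := Finset.mem_image.1 hp
    simp only [jumpIndex, Finset.mem_sigma, Finset.mem_univ, true_and, Finset.mem_Ico] at hki
    have h1 : (0 : ℝ) < i := by exact_mod_cast hki.1
    refine ⟨div_pos h1 (hpos' k), (div_lt_one (hpos' k)).2 ?_⟩
    exact_mod_cast hki.2
  · intro x hx hxP
    have hne : ∀ j, ∀ m : ℤ, (ν j : ℝ) * x ≠ m := fun j m hm => by
      have h0 : (0 : ℝ) < m := by rw [← hm]; exact mul_pos (hpos' j) hx.1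
      have h1 : (m : ℝ) < ν j := by rw [← hm]; exact mul_lt_of_lt_one_right (hpos' j) hx.2
      have h0' : 0 < m := by exact_mod_cast h0
      have h1' : m < ν j := by exact_mod_cast h1
      lift m to ℕ using h0'.le
      refine hxP (Finset.mem_image.2 ⟨⟨j, m⟩, ?_, ?_⟩)
      · simp only [jumpIndex, Finset.mem_sigma, Finset.mem_univ, true_and, Finset.mem_Ico]
        omega
      · have := (hpos' j).ne'
        simp only [jumpPoint]
        push_cast at hm
        rw [← hm]
        field_simp
    have h1 : ∀ j, HasDerivAt (fun x => f j (ν j * x)) (ν j * g j (ν j * x)) x := fun j => by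
      have h := (hd j _ (hne j)).scomp x ((hasDerivAt_id x).const_mul (ν j : ℝ))
      simpa [Function.comp_def] using h
    refine (HasDerivAt.fun_finsetProd fun j _ => h1 j).congr_deriv ?_
    refine Finset.sum_congr rfl fun k _ => ?_
    simp only [smul_eq_mul]
    ring

/-- The sums of f_k' are only controlled in the mean, since f_k' need not be differentiable; the
other factors are uniformly bounded and converge almost everywhere, and this pairing suffices. -/
lemma tendsto_integral_trigSum_mul_prod (hf : ∀ k, IsS1 (f k)) (hg : ∀ k, IsS1 (g k))
    (hd : ∀ k, ∀ x : ℝ, (∀ m : ℤ, x ≠ m) → HasDerivAt (f k) (g k x) x) (hpos : ∀ k, 0 < ν k)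
    (k : Fin (r + 1)) :
    Tendsto (fun N => ∫ x in (0 : ℝ)..1, ν k * (trigSum (fourierCoef (g k)) N (ν k * x) *
        ∏ j ∈ Finset.univ.erase k, trigSum (fourierCoef (f j)) N (ν j * x))) atTop
      (𝓝 (∫ x in (0 : ℝ)..1, ν k * (g k (ν k * x) * ∏ j ∈ Finset.univ.erase k, f j (ν j * x)))) := by
  have hpos' : ∀ k, (ν k : ℝ) ≠ 0 := fun k => by exact_mod_cast (hpos k).ne'
  choose C hC using fun j => ((hf j).isTame_fourierCoef (hg j) (hd j)).exists_norm_le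
  simp_rw [intervalIntegral.integral_const_mul]
  refine Tendsto.const_mul _ (tendsto_integral_mul_of_mean (C := ∏ j ∈ Finset.univ.erase k, C j)
    (fun N => by fun_prop) (fun N => by fun_prop) ?_ ?_ (fun N x => ?_) ?_)
  · obtain ⟨D, hD⟩ := (hg k).exists_norm_le
    have hgm := (hg k).measurable
    refine (_root_.intervalIntegrable_const (c := D)).mono_fun
      (by fun_prop : Measurable fun x : ℝ => g k (ν k * x)).aestronglyMeasurable
      (Eventually.of_forall fun x => (hD _).trans (le_abs_self _))
  · refine (hg k).tendsto_integral_norm_trigSum_sub.congr fun N => ?_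
    refine (integral_comp_natCast_mul_of_periodic
      (q := fun x => ‖trigSum (fourierCoef (g k)) N x - g k x‖) (fun x => ?_) (fun u v => ?_)
      (hpos k)).symm
    · have := trigSum_add_int (fourierCoef (g k)) N x 1
      rw [Int.cast_one] at this
      simp only [this, (hg k).periodic x]
    · exact ((Continuous.intervalIntegrable (by fun_prop) _ _).sub ((hg k).intervalIntegrable u v)).norm
  · rw [norm_prod]
    exact Finset.prod_le_prod (fun _ _ => norm_nonneg _) fun j _ => hC j N _
  · have hae : ∀ᵐ x : ℝ, ∀ j, (ν j : ℝ) * x ∉ Set.range ((↑) : ℤ → ℝ) :=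
      ae_all_iff.2 fun j => by
        have := (countable_mul_mem_range (hpos' j)).ae_notMem volume
        simpa using this
    filter_upwards [hae] with x hx
    refine tendsto_finsetProd _ fun j _ => ?_
    exact (hf j).tendsto_trigSum_fourierCoef (hd j _ fun m hm => hx j ⟨m, hm.symm⟩)

end Main

end FourierReciprocity

/-! ### The reciprocity formula -/

theorem mainTheorem2 (r : ℕ) (f : Fin (r + 1) → ℝ → ℂ) (ν : Fin (r + 1) → ℕ)
    (hf : ∀ k, FourierReciprocity.IsS1 (f k))
    (hf' : ∀ k, FourierReciprocity.DerivIsS1 (f k))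
    (hν_pos : ∀ k, 0 < ν k)
    (hν_inj : Function.Injective ν)
    (hν_cop : Pairwise fun i j => Nat.Coprime (ν i) (ν j)) :
    ∃ P : Fin (r + 1) → ℂ,
      (∀ k, FourierReciprocity.HasPrincipalValue (FourierReciprocity.orthLattice ν)
        (fun n => (ν k : ℂ) * FourierReciprocity.coefProd f k n) (P k)) ∧
      FourierReciprocity.reciprocity f ν =
        ∑ k, FourierReciprocity.jump (f k) * P k - FourierReciprocity.vectorJump f := by
  open FourierReciprocity in
  choose g hg hd using hf'
  choose P hP using fun k => exists_hasPrincipalValue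
    (fun j => (hf j).isTame_fourierCoef (hg j) (hd j)) (hν_pos k)
  refine ⟨P, hP, ?_⟩
  have h1 : Tendsto (fun N => ∑ k, jump (f k) *
      cubeSum (orthLattice ν) (fun n => (ν k : ℂ) * coefProd f k n) N) atTop
      (𝓝 (∑ k, jump (f k) * P k)) :=
    tendsto_finsetSum _ fun k _ => (hP k).const_mul _
  have h2 := tendsto_finsetSum Finset.univ fun k _ =>
    tendsto_integral_trigSum_mul_prod hf hg hd hν_pos k
  rw [sum_integral_deriv_prod hf hg hd hν_pos hν_cop] at h2
  rw [eq_sub_iff_add_eq, add_comm]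
  -- The two sequences agree for every N, so their limits do; the vanishing integral of the
  -- product's derivative supplies the identity.
  refine tendsto_nhds_unique h2 (h1.congr fun N => ?_)
  have h3 := sum_integral_deriv_trigSum_eq_zero ν (fun k => fourierCoef (f k)) N
  rw [← sub_eq_zero, ← neg_eq_zero, neg_sub, ← Finset.sum_sub_distrib, ← h3]
  refine Finset.sum_congr rfl fun k _ => ?_
  rw [cubeSum_coefProd_eq_integral, ← intervalIntegral.integral_const_mul,
    ← intervalIntegral.integral_const_mul, ← intervalIntegral.integral_sub
      (Continuous.intervalIntegrable (by fun_prop) _ _)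
      (Continuous.intervalIntegrable (by fun_prop) _ _)]
  congr 1
  ext x
  -- The differentiated partial sum is that of f_k' minus Δf_k times the Dirichlet kernel.
  have h4 : trigSum (fun n => 2 * Real.pi * Complex.I * n * fourierCoef (f k) n) N (ν k * x)
      = -jump (f k) * dirichletKernel N (ν k * x) + trigSum (fourierCoef (g k)) N (ν k * x) :=
    trigSum_eq_of_forall (fun n => by rw [(hf k).fourierCoef_deriv (hg k) (hd k)]; ring) N _
  rw [h4]
  ring
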